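/- Let $S^1=\mathbb R/\mathbb Z$ with Lebesgue measure $m$, let $D^2\subset\mathbb R^2$ be the closed unit disc with the Euclidean distance, and $X=S^1\times D^2$. Let $F:X\to X$ be a solenoidal map, i.e. a skew product $F(x,y)=(T(x),G(x,y))$ where $T:S^1\to S^1$ is of class $C^2$ and expanding ($|T'|>1$ everywhere), $G:X\to D^2$ is of class $C^2$ (so that $\partial G/\partial x$ is bounded), and the leaves $\{x\}\times D^2$ are uniformly contracted: there is $0<\alpha<1$ with $|G(x,y_1)-G(x,y_2)|\le\alpha|y_1-y_2|$ for all $x\in S^1$, $y_1,y_2\in D^2$. For a finite signed Borel measure $\mu$ on $X$ let $L_F\mu(E)=\mu(F^{-1}(E))$. For finite positive measures $\nu_1,\nu_2$ on $D^2$ put $W_1^0(\nu_1,\nu_2)=\sup\{|\int g\,d\nu_1-\int g\,d\nu_2| : g:D^2\to\mathbb R,\ \mathrm{Lip}(g)\le1,\ \|g\|_\infty\le1\}$. Write $\mu=\mu^+-\mu^-$ for the Jordan decomposition and $\pi_x:X\to S^1$ for the projection. Let $\mathcal{AB}$ be the set of finite signed Borel measures $\mu$ on $X$ such that $(\pi_x)_*\mu^{\pm}\ll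 m$; for such $\mu$ let $\phi_x^{\pm}$ be the densities of $(\pi_x)_*\mu^{\pm}$, let $\phi_x=\phi_x^+-\phi_x^-$, and let $\mu^{\pm}|_\gamma=\phi_x^{\pm}(\gamma)\,\mu^{\pm}_\gamma$, where $(\mu^{\pm}_\gamma)_{\gamma\in S^1}$ is the disintegration of $\mu^{\pm}$ into probability measures on the leaves $\{\gamma\}\times D^2\cong D^2$. Put $$\|\mu\|_{"1"}=\int_{S^1}W_1^0(\mu^+|_\gamma,\mu^-|_\gamma)\,dm(\gamma),\qquad \mathcal L^1=\{\mu\in\mathcal{AB}:\|\mu\|_{"1"}<\infty\},\qquad \mathcal V=\{\mu\in\mathcal L^1:\mu(X)=0\}.$$ Finally, $\|\phi\|_{W^{1,1}}=\|\phi\|_1+\|\phi'\|_1$ if $\phi$ agrees almost everywhere with an absolutely continuous function on $S^1$ (with derivative $\phi'\in L^1$), and $\|\phi\|_{W^{1,1}}=\infty$ otherwise. Then: (1) (Exponential convergence to equilibrium) There exist $D>0$ and $0<\beta<1$, depending only on $F$, such that for every $\mu\in\mathcal V$ and every $n\ge1$ one has $L_F^n\mu\in\mathcal L^1$ and $$\|L_F^n\mu\|_{"1"}\le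 D\,\beta^n\left(\|\mu\|_{"1"}+\|\phi_x\|_{W^{1,1}}\right).$$ (2) (Existence and uniqueness of the invariant measure) There is a positive measure $\mu\in\mathcal L^1$ with $\mu(X)=1$ and $L_F\mu=\mu$, and it is unique in $\mathcal L^1$ up to normalisation: every $\nu\in\mathcal L^1$ with $L_F\nu=\nu$ satisfies $\nu=\nu(X)\,\mu$. -/

import Mathlib

open MeasureTheory Set
open scoped ENNReal

noncomputable section

namespace Solenoid

/-- The closed unit disc `D²` of the Euclidean plane. -/
abbrev Disc : Type := ↥(Metric.closedBall (0 : EuclideanSpace ℝ (Fin 2)) 1)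

instance : Nonempty Disc := ⟨⟨0, by simp⟩⟩

instance : StandardBorelSpace Disc := Metric.isClosed_closedBall.measurableSet.standardBorel

/-- The filled torus `X = S¹ × D²`, where `S¹ = ℝ / ℤ`. -/
abbrev SolidTorus : Type := UnitAddCircle × Disc

/-- `T : S¹ → S¹` is a `C²` expanding map: it has a `C²` lift `τ : ℝ → ℝ` to the universal cover,
with `|τ'| > 1` everywhere. (The degree of `T` is the constant integer `τ (x + 1) - τ x`.) -/
def IsExpandingMap (T : UnitAddCircle → UnitAddCircle) : Prop :=
  ∃ τ : ℝ → ℝ, ContDiff ℝ 2 τ ∧ (∀ x : ℝ, ((τ x : ℝ) : UnitAddCircle) = T (x : UnitAddCircle)) ∧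
    ∀ x : ℝ, 1 < |deriv τ x|

/-- `G : S¹ × D² → D²` is of class `C²`: in the coordinates `(x, y) ∈ ℝ × D²` of the universal
cover, it is `C²` up to the boundary of the disc. In particular, by compactness, the first
derivatives of `G` are bounded. -/
def IsC2FiberMap (G : SolidTorus → Disc) : Prop :=
  ∃ g : ℝ × EuclideanSpace ℝ (Fin 2) → EuclideanSpace ℝ (Fin 2),
    ContDiffOn ℝ 2 g (univ ×ˢ Metric.closedBall 0 1) ∧
    ∀ (x : ℝ) (y : Disc), g (x, (y : EuclideanSpace ℝ (Fin 2))) = G ((x : UnitAddCircle), y)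

/-- The skew product `F (x, y) = (T x, G (x, y))`. -/
def skewProduct (T : UnitAddCircle → UnitAddCircle) (G : SolidTorus → Disc)
    (p : SolidTorus) : SolidTorus :=
  (T p.1, G p)

/-- The skew product of `T` and `G` is a solenoidal map. -/
structure IsSolenoidal (T : UnitAddCircle → UnitAddCircle) (G : SolidTorus → Disc) : Prop where
  expanding : IsExpandingMap T
  smooth : IsC2FiberMap G
  contracting : ∃ α : ℝ, 0 < α ∧ α < 1 ∧
    ∀ (x : UnitAddCircle) (y₁ y₂ : Disc), dist (G (x, y₁)) (G (x, y₂)) ≤ α * dist y₁ y₂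

/-- The transfer operator `(L_F μ)(E) = μ (F⁻¹ E)` on signed measures (`F` is continuous, hence
measurable, when it is solenoidal). -/
def transfer (F : SolidTorus → SolidTorus) (μ : SignedMeasure SolidTorus) :
    SignedMeasure SolidTorus :=
  μ.map F

/-- The positive part `μ⁺` of the Jordan decomposition. -/
def pos (μ : SignedMeasure SolidTorus) : Measure SolidTorus := μ.toJordanDecomposition.posPart

/-- The negative part `μ⁻` of the Jordan decomposition. -/
def neg (μ : SignedMeasure SolidTorus) : Measure SolidTorus := μ.toJordanDecomposition.negPart

instance (μ : SignedMeasure SolidTorus) : IsFiniteMeasure (pos μ) :=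
  μ.toJordanDecomposition.posPart_finite

instance (μ : SignedMeasure SolidTorus) : IsFiniteMeasure (neg μ) :=
  μ.toJordanDecomposition.negPart_finite

/-- The space `𝒜ℬ`: the marginals on `S¹` of `μ⁺` and `μ⁻` are absolutely continuous with respect
to Lebesgue measure. -/
def IsAB (μ : SignedMeasure SolidTorus) : Prop :=
  (pos μ).fst ≪ volume ∧ (neg μ).fst ≪ volume

/-- The restriction `ν|_γ = φ(γ) ν_γ` of a finite positive measure to the leaf `{γ} × D²`, as a
measure on `D²`: here `φ` is the density of the marginal of `ν` on `S¹` and `(ν_γ)` is the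
disintegration of `ν` into probability measures on the leaves. -/
def leaf (ν : Measure SolidTorus) [IsFiniteMeasure ν] (γ : UnitAddCircle) : Measure Disc :=
  ν.fst.rnDeriv volume γ • ν.condKernel γ

/-- The Wasserstein-Kantorovich-like distance
`W₁⁰(ν₁, ν₂) = sup { |∫ g dν₁ - ∫ g dν₂| : Lip g ≤ 1, ‖g‖_∞ ≤ 1 }`. -/
def wasserstein (ν₁ ν₂ : Measure Disc) : ℝ≥0∞ :=
  ⨆ (g : Disc → ℝ) (_ : LipschitzWith 1 g) (_ : ∀ y, |g y| ≤ 1),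
    ENNReal.ofReal |∫ y, g y ∂ν₁ - ∫ y, g y ∂ν₂|

/-- The norm `‖μ‖_"1" = ∫_{S¹} W₁⁰(μ⁺|_γ, μ⁻|_γ) dm(γ)`. -/
def weakNorm (μ : SignedMeasure SolidTorus) : ℝ≥0∞ :=
  ∫⁻ γ : UnitAddCircle, wasserstein (leaf (pos μ) γ) (leaf (neg μ) γ)

/-- The space `ℒ¹` of disintegrated signed measures. -/
def spaceL1 : Set (SignedMeasure SolidTorus) := {μ | IsAB μ ∧ weakNorm μ < ∞}

/-- The space `𝒱` of zero average measures in `ℒ¹`. -/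
def zeroAverage : Set (SignedMeasure SolidTorus) := {μ | μ ∈ spaceL1 ∧ μ univ = 0}

/-- The marginal density `φ_x = φ_x⁺ - φ_x⁻` of `μ` on `S¹`. -/
def marginalDensity (μ : SignedMeasure SolidTorus) (γ : UnitAddCircle) : ℝ :=
  ((pos μ).fst.rnDeriv volume γ).toReal - ((neg μ).fst.rnDeriv volume γ).toReal

/-- `f` is absolutely continuous on the circle `S¹ = ℝ / ℤ` with derivative `f' ∈ L¹`.
(At `x = 1` the condition forces `∫ f' = 0`, since `f` is a function on the circle.) -/
def HasL1Deriv (f f' : UnitAddCircle → ℝ) : Prop :=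
  Integrable f' volume ∧
    ∀ x ∈ Icc (0 : ℝ) 1,
      f (x : UnitAddCircle) = f 0 + ∫ t in (0 : ℝ)..x, f' (t : UnitAddCircle)

/-- The Sobolev norm `‖φ‖_{W^{1,1}} = ‖φ‖_1 + ‖φ'‖_1` of (the almost everywhere class of) `φ`.
The absolutely continuous representative is unique and its derivative is unique almost everywhere,
so the infimum ranges over a single value; it is `∞` if `φ` does not belong to `W^{1,1}(S¹)`. -/
def sobolevNorm (φ : UnitAddCircle → ℝ) : ℝ≥0∞ :=
  ⨅ (f : UnitAddCircle → ℝ) (f' : UnitAddCircle → ℝ) (_ : HasL1Deriv f f')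
    (_ : f =ᵐ[volume] φ), eLpNorm f 1 volume + eLpNorm f' 1 volume

end Solenoid

end

/-!
Call a function on the circle a cone function if it is nonnegative with `a`-Lipschitz logarithm.
The transfer operator of the expanding map `T` improves the constant `a` to some `b < a`, so that a
fixed fraction of the mass of the image can be split off as a constant. Hence the images of two cone
functions of the same mass approach each other exponentially fast, and so do those of two Lipschitz
functions, which become cone functions after adding a constant. A function in `W^{1,1}` is replaced
by its Steklov average over a window of exponentially small length, at the price of half the rate.

On the solid torus, `weakNorm μ` is the supremum of `∫ h dμ` over the measurable functions `h` that
are bounded by `1` and `1`-Lipschitz along each leaf, since such functions can be glued along a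
measurable partition of the base. In `h ∘ F^(k + l)` the last `k` iterates contract the leaves by
`α ^ k`, so up to an error `α ^ k * weakNorm μ` only the values of `h ∘ F^k` on the central section
count. These depend on the base point alone, and the first `l` iterates average them out by the
decay on the circle. The choice `k = n / 2` gives the exponential rate.

For arbitrary integrable marginals, approximation by Lipschitz functions still gives convergence to
zero without a rate. This yields uniqueness of the invariant measure, and it shows that a weak limit
point of the iterates of an absolutely continuous measure is invariant. Its marginal is absolutely
continuous, because the densities of the images of Lebesgue measure under `T^n` are uniformly
bounded.
-/

noncomputable section

open Filter Topology
open scoped NNReal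

namespace Solenoid

section LogLipschitz

variable {α β : Type*} [PseudoMetricSpace α] [PseudoMetricSpace β] {a b : ℝ} {f g : α → ℝ}

/-- `f` is nonnegative and `log f` is `a`-Lipschitz. These functions form the cone that is
contracted by the transfer operator of an expanding map. The condition is written multiplicatively,
so that the zero function is included. -/
structure LogLipschitzWith (a : ℝ) (f : α → ℝ) : Prop where
  nonneg : ∀ x, 0 ≤ f x
  le_exp_mul : ∀ x y, f x ≤ Real.exp (a * dist x y) * f y

namespace LogLipschitzWith

theorem const (ha : 0 ≤ a) {c : ℝ} (hc : 0 ≤ c) : LogLipschitzWith a (fun _ : α => c) where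
  nonneg _ := hc
  le_exp_mul _ _ :=
    le_mul_of_one_le_left hc (Real.one_le_exp (mul_nonneg ha dist_nonneg))

theorem mono (hf : LogLipschitzWith a f) (hab : a ≤ b) : LogLipschitzWith b f where
  nonneg := hf.nonneg
  le_exp_mul x y := (hf.le_exp_mul x y).trans <|
    mul_le_mul_of_nonneg_right (Real.exp_le_exp.2 (by gcongr)) (hf.nonneg y)

theorem mul (hf : LogLipschitzWith a f) (hg : LogLipschitzWith b g) :
    LogLipschitzWith (a + b) (fun x => f x * g x) where
  nonneg x := mul_nonneg (hf.nonneg x) (hg.nonneg x)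
  le_exp_mul x y := calc
    f x * g x ≤ (Real.exp (a * dist x y) * f y) * (Real.exp (b * dist x y) * g y) :=
      mul_le_mul (hf.le_exp_mul x y) (hg.le_exp_mul x y) (hg.nonneg x)
        (mul_nonneg (Real.exp_nonneg _) (hf.nonneg y))
    _ = Real.exp ((a + b) * dist x y) * (f y * g y) := by
      rw [add_mul, Real.exp_add]
      ring

theorem inv (hf : LogLipschitzWith a f) : LogLipschitzWith a (fun x => (f x)⁻¹) where
  nonneg x := inv_nonneg.2 (hf.nonneg x)
  le_exp_mul x y := by
    rcases (hf.nonneg x).eq_or_lt with hx | hx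
    · rw [← hx, inv_zero]
      exact mul_nonneg (Real.exp_nonneg _) (inv_nonneg.2 (hf.nonneg y))
    · have hyx : f y ≤ Real.exp (a * dist x y) * f x := dist_comm y x ▸ hf.le_exp_mul y x
      have hy : 0 < f y :=
        pos_of_mul_pos_right (hx.trans_le (hf.le_exp_mul x y)) (Real.exp_nonneg _)
      rw [← div_eq_mul_inv, inv_eq_one_div, div_le_div_iff₀ hx hy, one_mul]
      exact hyx

theorem sum {ι : Type*} (s : Finset ι) {f : ι → α → ℝ} (hf : ∀ i ∈ s, LogLipschitzWith a (f i)) :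
    LogLipschitzWith a (fun x => ∑ i ∈ s, f i x) where
  nonneg x := Finset.sum_nonneg fun i hi => (hf i hi).nonneg x
  le_exp_mul x y := by
    rw [Finset.mul_sum]
    exact Finset.sum_le_sum fun i hi => (hf i hi).le_exp_mul x y

theorem comp_lipschitzWith (hf : LogLipschitzWith a f) (ha : 0 ≤ a) {K : ℝ≥0} {φ : β → α}
    (hφ : LipschitzWith K φ) : LogLipschitzWith (a * K) (f ∘ φ) where
  nonneg x := hf.nonneg (φ x)
  le_exp_mul x y := (hf.le_exp_mul (φ x) (φ y)).trans <| by
    rw [mul_assoc]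
    exact mul_le_mul_of_nonneg_right
      (Real.exp_le_exp.2 (mul_le_mul_of_nonneg_left (hφ.dist_le_mul x y) ha)) (hf.nonneg _)

theorem of_lipschitzWith {K : ℝ≥0} (hf : LipschitzWith K f) (h0 : ∀ x, 0 ≤ f x)
    (hK : ∀ x, K ≤ a * f x) : LogLipschitzWith a f where
  nonneg := h0
  le_exp_mul x y := calc
    f x ≤ f y + K * dist x y := hf.le_add_mul x y
    _ ≤ f y + a * f y * dist x y := by gcongr; exact hK y
    _ = (a * dist x y + 1) * f y := by ring
    _ ≤ Real.exp (a * dist x y) * f y :=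
      mul_le_mul_of_nonneg_right (Real.add_one_le_exp _) (h0 y)

/-- Convexity of the exponential: `exp (a (1 - ε) d) ≤ (1 - ε) exp (a d) + ε`. -/
theorem sub_const {ε c : ℝ} (hf : LogLipschitzWith (a * (1 - ε)) f) (ha : 0 ≤ a) (hε₀ : 0 ≤ ε)
    (hε₁ : ε ≤ 1) (hc : ∀ x, c ≤ ε * f x) : LogLipschitzWith a (fun x => f x - c) where
  nonneg x := sub_nonneg.2 ((hc x).trans (mul_le_of_le_one_left (hf.nonneg x) hε₁))
  le_exp_mul x y := by
    set t := a * dist x y with ht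
    have hconv : Real.exp (a * (1 - ε) * dist x y) ≤ (1 - ε) * Real.exp t + ε := by
      have := convexOn_exp.2 (mem_univ t) (mem_univ 0) (sub_nonneg.2 hε₁) hε₀ (by ring)
      simp only [smul_eq_mul, mul_zero, add_zero, Real.exp_zero, mul_one] at this
      rwa [show a * (1 - ε) * dist x y = (1 - ε) * t by rw [ht]; ring]
    have hexp : 1 ≤ Real.exp t := Real.one_le_exp (mul_nonneg ha dist_nonneg)
    calc f x - c ≤ ((1 - ε) * Real.exp t + ε) * f y - c := by
          gcongr
          exact (hf.le_exp_mul x y).trans (mul_le_mul_of_nonneg_right hconv (hf.nonneg y))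
      _ ≤ Real.exp t * (f y - c) := by
          nlinarith [mul_le_mul_of_nonneg_left (hc y) (sub_nonneg.2 hexp)]

theorem continuous (hf : LogLipschitzWith a f) : Continuous f := by
  refine continuous_iff_continuousAt.2 fun y => ?_
  have hd : Tendsto (fun x => a * dist x y) (𝓝 y) (𝓝 0) := by
    have : Continuous fun x => a * dist x y := by fun_prop
    simpa using this.tendsto y
  have hlower : Tendsto (fun x => Real.exp (-(a * dist x y)) * f y) (𝓝 y) (𝓝 (f y)) := by
    simpa using ((Real.continuous_exp.tendsto _).comp hd.neg).mul_const (f y)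
  have hupper : Tendsto (fun x => Real.exp (a * dist x y) * f y) (𝓝 y) (𝓝 (f y)) := by
    simpa using ((Real.continuous_exp.tendsto _).comp hd).mul_const (f y)
  refine tendsto_of_tendsto_of_tendsto_of_le_of_le hlower hupper (fun x => ?_)
    fun x => hf.le_exp_mul x y
  dsimp only
  rw [Real.exp_neg, inv_mul_le_iff₀ (Real.exp_pos _), dist_comm]
  exact hf.le_exp_mul y x

theorem le_exp_diam_mul [CompactSpace α] (hf : LogLipschitzWith a f) (ha : 0 ≤ a) (x y : α) :
    f x ≤ Real.exp (a * Metric.diam (univ : Set α)) * f y :=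
  (hf.le_exp_mul x y).trans <| mul_le_mul_of_nonneg_right
    (Real.exp_le_exp.2 <| mul_le_mul_of_nonneg_left
      (Metric.dist_le_diam_of_mem isCompact_univ.isBounded (mem_univ x) (mem_univ y)) ha)
    (hf.nonneg y)

section Integral

variable [CompactSpace α] [MeasurableSpace α] [OpensMeasurableSpace α] {m : Measure α}

theorem integrable [IsFiniteMeasureOnCompacts m] (hf : LogLipschitzWith a f) : Integrable f m :=
  hf.continuous.integrable_of_hasCompactSupport (.of_compactSpace f)

variable [IsProbabilityMeasure m]

theorem integral_le (hf : LogLipschitzWith a f) (ha : 0 ≤ a) (x : α) :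
    ∫ y, f y ∂m ≤ Real.exp (a * Metric.diam (univ : Set α)) * f x := by
  simpa using integral_mono (μ := m) hf.integrable (integrable_const _)
    fun y => hf.le_exp_diam_mul ha y x

theorem le_integral (hf : LogLipschitzWith a f) (ha : 0 ≤ a) (x : α) :
    f x ≤ Real.exp (a * Metric.diam (univ : Set α)) * ∫ y, f y ∂m := by
  have := integral_mono (μ := m) (integrable_const (f x)) (hf.integrable.const_mul _)
    fun y => hf.le_exp_diam_mul ha x y
  simpa [integral_const_mul] using this

theorem sub_integral_add_const {K : ℝ≥0} (hf : LipschitzWith K f) (ha : 0 < a) :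
    LogLipschitzWith a
      fun x => f x - ∫ y, f y ∂m + K * (Metric.diam (univ : Set α) + a⁻¹) := by
  have hosc (x : α) : ∫ y, f y ∂m ≤ f x + K * Metric.diam (univ : Set α) := by
    have hfi : Integrable f m := hf.continuous.integrable_of_hasCompactSupport (.of_compactSpace f)
    simpa using integral_mono hfi (integrable_const (f x + K * Metric.diam univ)) fun y =>
      (hf.le_add_mul y x).trans <| by
        gcongr
        exact Metric.dist_le_diam_of_mem isCompact_univ.isBounded (mem_univ y) (mem_univ x)
  have hlower (x : α) :
      K * a⁻¹ ≤ f x - ∫ y, f y ∂m + K * (Metric.diam (univ : Set α) + a⁻¹) := by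
    linarith [hosc x, mul_add (K : ℝ) (Metric.diam (univ : Set α)) a⁻¹]
  refine .of_lipschitzWith (K := K) (.of_le_add_mul K fun x y => ?_)
    (fun x => (mul_nonneg K.2 (inv_nonneg.2 ha.le)).trans (hlower x)) fun x => ?_
  · linarith [hf.le_add_mul x y]
  · rw [← inv_mul_le_iff₀ ha, mul_comm]
    exact hlower x

end Integral

end LogLipschitzWith

end LogLipschitz

section LipschitzDense

variable {X : Type*} [PseudoMetricSpace X] [MeasurableSpace X] [BorelSpace X] {m : Measure X}
  [IsFiniteMeasure m]

theorem exists_lipschitzWith_integral_abs_sub_indicator_le {s : Set X} (hs : MeasurableSet s)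
    {ε : ℝ} (hε : 0 < ε) :
    ∃ (ψ : X → ℝ) (K : ℝ≥0), LipschitzWith K ψ ∧ Integrable ψ m ∧
      ∫ x, |ψ x - s.indicator 1 x| ∂m ≤ ε := by
  obtain ⟨F, hFs, hF, hsF⟩ := hs.exists_isClosed_sdiff_lt (measure_ne_top m s)
    (ENNReal.ofReal_pos.2 (half_pos hε)).ne'
  obtain ⟨δ, hδ, hψF⟩ : ∃ (δ : ℝ) (hδ : 0 < δ),
      ∫ x, (thickenedIndicator hδ F x : ℝ) ∂m < m.real F + ε / 2 := by
    have hδ (n : ℕ) : 0 < 1 / ((n : ℝ) + 1) := Nat.one_div_pos_of_nat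
    obtain ⟨n, hn⟩ := ((tendsto_integral_thickenedIndicator_of_isClosed m hF hδ
      tendsto_one_div_add_atTop_nhds_zero_nat).eventually_lt_const
        (lt_add_of_pos_right _ (half_pos hε))).exists
    exact ⟨_, hδ n, hn⟩
  have hψ := integrable_thickenedIndicator (μ := m) F hδ
  have hind {A : Set X} (hA : MeasurableSet A) : Integrable (A.indicator (1 : X → ℝ)) m :=
    (integrable_const 1).indicator hA
  have hdiff : MeasurableSet (s \ F) := hs.diff hF.measurableSet
  refine ⟨fun x => thickenedIndicator hδ F x, _,
    NNReal.isometry_coe.lipschitz.comp (lipschitzWith_thickenedIndicator hδ F), hψ, ?_⟩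
  calc ∫ x, |(thickenedIndicator hδ F x : ℝ) - s.indicator 1 x| ∂m
      ≤ ∫ x, (((thickenedIndicator hδ F x : ℝ) - F.indicator 1 x) + (s \ F).indicator 1 x) ∂m := by
        refine integral_mono (hψ.sub (hind hs)).abs
          ((hψ.sub (hind hF.measurableSet)).add (hind hdiff)) fun x => ?_
        have h0 : 0 ≤ (thickenedIndicator hδ F x : ℝ) := NNReal.coe_nonneg _
        by_cases hxF : x ∈ F
        · simp [hxF, hFs hxF, thickenedIndicator_one hδ F hxF]
        · by_cases hxs : x ∈ s
          · simpa [hxF, hxs, abs_of_nonneg h0] using abs_sub (thickenedIndicator hδ F x : ℝ) 1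
          · simp [hxF, hxs]
    _ = (∫ x, (thickenedIndicator hδ F x : ℝ) ∂m - m.real F) + m.real (s \ F) := by
        rw [integral_add (by exact hψ.sub (hind hF.measurableSet)) (hind hdiff),
          integral_sub hψ (hind hF.measurableSet), integral_indicator_one hF.measurableSet,
          integral_indicator_one hdiff]
    _ ≤ ε := by
        have : m.real (s \ F) ≤ ε / 2 := ENNReal.toReal_le_of_le_ofReal (half_pos hε).le hsF.le
        linarith

theorem exists_lipschitzWith_integral_abs_sub_le {φ : X → ℝ} (hφ : Integrable φ m) {ε : ℝ}
    (hε : 0 < ε) :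
    ∃ (ψ : X → ℝ) (K : ℝ≥0), LipschitzWith K ψ ∧ Integrable ψ m ∧ ∫ x, |φ x - ψ x| ∂m ≤ ε := by
  have key := (memLp_one_iff_integrable.2 hφ).induction_dense ENNReal.one_ne_top
    (fun ψ => (∃ K, LipschitzWith K ψ) ∧ Integrable ψ m) ?_ ?_
    (fun ψ hψ => hψ.2.aestronglyMeasurable) (ENNReal.ofReal_pos.2 hε).ne'
  · obtain ⟨ψ, hle, ⟨K, hK⟩, hψ⟩ := key
    refine ⟨ψ, K, hK, hψ, ?_⟩
    rw [eLpNorm_one_eq_lintegral_enorm,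
      ← ofReal_integral_norm_eq_lintegral_enorm (hφ.sub hψ)] at hle
    exact (ENNReal.ofReal_le_ofReal_iff hε.le).1 hle
  · intro c s hs _ ε hε
    obtain ⟨η, hη, hηε⟩ : ∃ η : ℝ, 0 < η ∧ ENNReal.ofReal (|c| * η) ≤ ε := by
      have : Tendsto (fun η : ℝ => ENNReal.ofReal (|c| * η)) (𝓝[>] 0) (𝓝 0) := by
        have : Continuous fun η : ℝ => ENNReal.ofReal (|c| * η) :=
          ENNReal.continuous_ofReal.comp (by fun_prop)
        simpa using (this.tendsto 0).mono_left nhdsWithin_le_nhds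
      obtain ⟨η, h1, h2⟩ := ((this.eventually_lt_const hε.bot_lt).and self_mem_nhdsWithin).exists
      exact ⟨η, h2, h1.le⟩
    obtain ⟨ψ, K, hK, hψ, hle⟩ := exists_lipschitzWith_integral_abs_sub_indicator_le (m := m) hs hη
    refine ⟨c • ψ, ?_, ⟨_, (lipschitzWith_smul c).comp hK⟩, hψ.smul c⟩
    have hcs : (s.indicator fun _ => c) = c • s.indicator (1 : X → ℝ) := by
      ext x
      by_cases hx : x ∈ s <;> simp [hx]
    have hs1 : Integrable (s.indicator (1 : X → ℝ)) m := (integrable_const 1).indicator hs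
    rw [hcs, ← smul_sub, eLpNorm_const_smul, eLpNorm_one_eq_lintegral_enorm,
      ← ofReal_integral_norm_eq_lintegral_enorm (hψ.sub hs1), Real.enorm_eq_ofReal_abs,
      ← ENNReal.ofReal_mul (abs_nonneg c)]
    exact (ENNReal.ofReal_le_ofReal (by gcongr; exact hle)).trans hηε
  · rintro f g ⟨⟨K, hK⟩, hf⟩ ⟨⟨L, hL⟩, hg⟩
    exact ⟨⟨K + L, hK.add hL⟩, hf.add hg⟩

end LipschitzDense

section Cone

variable {X : Type*} [MeasurableSpace X] {m : Measure X} {T : X → X} {f g : X → ℝ}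

/-- `g` is the image of the density `f` under the transfer operator of `T` on `(X, m)`: pushing
forward `f m` by `T` gives `g m`. The densities may be signed, so this is tested against bounded
measurable functions. -/
def IsTransferDensity (m : Measure X) (T : X → X) (f g : X → ℝ) : Prop :=
  ∀ u : X → ℝ, Measurable u → (∃ C, ∀ x, |u x| ≤ C) →
    ∫ x, u (T x) * f x ∂m = ∫ x, u x * g x ∂m

theorem IsTransferDensity.integral_eq (h : IsTransferDensity m T f g) :
    ∫ x, f x ∂m = ∫ x, g x ∂m := by
  simpa using h (fun _ => 1) measurable_const ⟨1, by simp⟩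

theorem IsTransferDensity.comp {S : X → X} {k : X → ℝ} (hS : IsTransferDensity m S g k)
    (hT : IsTransferDensity m T f g) (hSm : Measurable S) :
    IsTransferDensity m (S ∘ T) f k := fun u hu ⟨C, hC⟩ =>
  (hT (u ∘ S) (hu.comp hSm) ⟨C, fun x => hC (S x)⟩).trans (hS u hu ⟨C, hC⟩)

theorem abs_integral_mul_sub_integral_sub_le [IsProbabilityMeasure m] {v φ ψ : X → ℝ}
    (hv : Measurable v) (hv1 : ∀ x, |v x| ≤ 1) (hφ : Integrable φ m) (hψ : Integrable ψ m) :
    |∫ x, v x * (φ x - ∫ y, φ y ∂m) ∂m - ∫ x, v x * (ψ x - ∫ y, ψ y ∂m) ∂m| ≤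
      2 * ∫ x, |φ x - ψ x| ∂m := by
  have hv1' : ∀ᵐ x ∂m, ‖v x‖ ≤ 1 := .of_forall hv1
  have hi {k : X → ℝ} (hk : Integrable k m) : Integrable (fun x => v x * k x) m :=
    hk.bdd_mul hv.aestronglyMeasurable hv1'
  have hc {k : X → ℝ} (hk : Integrable k m) : Integrable (fun x => k x - ∫ y, k y ∂m) m :=
    hk.sub (integrable_const _)
  have habs : Integrable (fun x => |φ x - ψ x|) m := (hφ.sub hψ).abs
  have hint : |∫ x, (φ x - ψ x) ∂m| ≤ ∫ x, |φ x - ψ x| ∂m := abs_integral_le_integral_abs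
  rw [← integral_sub (hi (hc hφ)) (hi (hc hψ))]
  calc |∫ x, (v x * (φ x - ∫ y, φ y ∂m) - v x * (ψ x - ∫ y, ψ y ∂m)) ∂m|
      ≤ ∫ x, (|φ x - ψ x| + |∫ y, (φ y - ψ y) ∂m|) ∂m := by
        refine norm_integral_le_of_norm_le (G := ℝ) (habs.add (integrable_const _))
          (.of_forall fun x => ?_)
        rw [integral_sub hφ hψ, ← mul_sub, norm_mul, sub_sub_sub_comm]
        exact (mul_le_of_le_one_left (norm_nonneg _) (hv1 x)).trans (abs_sub _ _)
    _ ≤ 2 * ∫ x, |φ x - ψ x| ∂m := by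
        rw [integral_add habs (integrable_const _)]
        simp only [integral_const, probReal_univ, one_smul]
        linarith

variable [PseudoMetricSpace X] {a b : ℝ}

/-- The transfer operator of `T` on `(X, m)` maps the cone of functions with `a`-Lipschitz
logarithm into the smaller cone of functions with `b`-Lipschitz logarithm. -/
structure ContractsCone (m : Measure X) (T : X → X) (a b : ℝ) : Prop where
  measurable : Measurable T
  right_pos : 0 < b
  right_lt_left : b < a
  exists_isTransferDensity : ∀ f, LogLipschitzWith a f →
    ∃ g, LogLipschitzWith b g ∧ IsTransferDensity m T f g

/-- The rate at which `ContractsCone m T a b` makes two densities of equal mass coalesce. -/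
def coneRate (X : Type*) [PseudoMetricSpace X] (a b : ℝ) : ℝ :=
  1 - (1 - b / a) * Real.exp (-(a * Metric.diam (univ : Set X)))

namespace ContractsCone

variable (S : ContractsCone m T a b)

include S

theorem left_pos : 0 < a := S.right_pos.trans S.right_lt_left

theorem one_sub_div_pos : 0 < 1 - b / a :=
  sub_pos.2 ((div_lt_one S.left_pos).2 S.right_lt_left)

theorem coneRate_pos : 0 < coneRate X a b := by
  have hexp : Real.exp (-(a * Metric.diam (univ : Set X))) ≤ 1 :=
    Real.exp_le_one_iff.2 (neg_nonpos.2 (mul_nonneg S.left_pos.le Metric.diam_nonneg))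
  have := div_pos S.right_pos S.left_pos
  have := S.one_sub_div_pos
  rw [coneRate]
  nlinarith

theorem coneRate_lt_one : coneRate X a b < 1 :=
  sub_lt_self _ (mul_pos S.one_sub_div_pos (Real.exp_pos _))

theorem exists_isTransferDensity_iterate (n : ℕ) (hf : LogLipschitzWith a f) :
    ∃ g, LogLipschitzWith a g ∧ IsTransferDensity m T^[n] f g := by
  induction n generalizing f with
  | zero => exact ⟨f, hf, fun _ _ _ => rfl⟩
  | succ n ih =>
    obtain ⟨g, hg, hfg⟩ := S.exists_isTransferDensity f hf
    obtain ⟨k, hk, hgk⟩ := ih (hg.mono S.right_lt_left.le)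
    exact ⟨k, hk, hgk.comp hfg (S.measurable.iterate n)⟩

variable [CompactSpace X] [BorelSpace X] [IsProbabilityMeasure m]

/-- A density in the smaller cone is bounded below by a fixed fraction of its integral, so that
fraction of the mass can be split off as a constant without leaving the larger cone. -/
theorem exists_isTransferDensity_add_const (hf : LogLipschitzWith a f) :
    ∃ g, LogLipschitzWith a g ∧ ∫ x, g x ∂m = coneRate X a b * ∫ x, f x ∂m ∧
      IsTransferDensity m T f (fun x => g x + (1 - coneRate X a b) * ∫ y, f y ∂m) := by
  obtain ⟨g, hg, hfg⟩ := S.exists_isTransferDensity f hf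
  have ha := S.left_pos
  refine ⟨fun x => g x - (1 - coneRate X a b) * ∫ y, f y ∂m, ?_, ?_, by simpa using hfg⟩
  · refine LogLipschitzWith.sub_const (ε := 1 - b / a) ?_ ha.le S.one_sub_div_pos.le
      (sub_le_self _ (div_pos S.right_pos ha).le) fun x => ?_
    · rwa [sub_sub_cancel, mul_div_cancel₀ _ ha.ne']
    · rw [coneRate, sub_sub_cancel, mul_assoc, hfg.integral_eq, Real.exp_neg]
      refine mul_le_mul_of_nonneg_left ?_ S.one_sub_div_pos.le
      rw [inv_mul_le_iff₀ (Real.exp_pos _)]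
      exact (hg.mono S.right_lt_left.le).integral_le ha.le x
  · rw [integral_sub hg.integrable (integrable_const _), hfg.integral_eq, integral_const,
      probReal_univ, one_smul]
    ring

theorem abs_integral_comp_iterate_mul_sub_le {u : X → ℝ} (hu : Measurable u)
    (hu1 : ∀ x, |u x| ≤ 1) (n : ℕ) (hf : LogLipschitzWith a f)
    (hg : LogLipschitzWith a g) (hfg : ∫ x, f x ∂m = ∫ x, g x ∂m) :
    |∫ x, u (T^[n] x) * f x ∂m - ∫ x, u (T^[n] x) * g x ∂m| ≤
      2 * coneRate X a b ^ n * ∫ x, f x ∂m := by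
  induction n generalizing f g with
  | zero =>
    have habs {f : X → ℝ} (hf : LogLipschitzWith a f) :
        |∫ x, u x * f x ∂m| ≤ ∫ x, f x ∂m :=
      norm_integral_le_of_norm_le (f := fun x => u x * f x) hf.integrable <| .of_forall fun x => by
        rw [Real.norm_eq_abs, abs_mul, abs_of_nonneg (hf.nonneg x)]
        exact mul_le_of_le_one_left (hf.nonneg x) (hu1 x)
    simp only [Function.iterate_zero, id, pow_zero, mul_one]
    linarith [abs_sub (∫ x, u x * f x ∂m) (∫ x, u x * g x ∂m), habs hf, habs hg]
  | succ n ih =>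
    obtain ⟨f', hf', hmassf, hff'⟩ := S.exists_isTransferDensity_add_const hf
    obtain ⟨g', hg', hmassg, hgg'⟩ := S.exists_isTransferDensity_add_const hg
    rw [← hfg] at hgg' hmassg
    set c := (1 - coneRate X a b) * ∫ y, f y ∂m
    have hv : Measurable fun x => u (T^[n] x) := hu.comp (S.measurable.iterate n)
    have hstep {f f' : X → ℝ} (hf' : LogLipschitzWith a f')
        (hff' : IsTransferDensity m T f fun x => f' x + c) :
        ∫ x, u (T^[n + 1] x) * f x ∂m
          = ∫ x, u (T^[n] x) * f' x ∂m + ∫ x, u (T^[n] x) * c ∂m := by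
      have hv1 : ∀ᵐ x ∂m, ‖u (T^[n] x)‖ ≤ 1 := .of_forall fun _ => hu1 _
      simp only [Function.iterate_succ_apply]
      rw [hff' _ hv ⟨1, fun _ => hu1 _⟩, ← integral_add]
      · simp only [mul_add]
      · exact hf'.integrable.bdd_mul hv.aestronglyMeasurable hv1
      · exact (integrable_const c).bdd_mul hv.aestronglyMeasurable hv1
    rw [hstep hf' hff', hstep hg' hgg', add_sub_add_right_eq_sub]
    refine (ih hf' hg' (hmassf.trans hmassg.symm)).trans_eq ?_
    rw [hmassf]
    ring

theorem map_iterate_le (n : ℕ) :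
    m.map T^[n] ≤ ENNReal.ofReal (Real.exp (a * Metric.diam (univ : Set X))) • m := by
  set C := Real.exp (a * Metric.diam (univ : Set X))
  obtain ⟨g, hg, h⟩ := S.exists_isTransferDensity_iterate n (.const S.left_pos.le zero_le_one)
  have hg1 : ∫ x, g x ∂m = 1 := by simpa using h.integral_eq.symm
  have hgC (x : X) : g x ≤ C := by simpa [hg1] using hg.le_integral (m := m) S.left_pos.le x
  refine Measure.le_iff.2 fun E hE => ?_
  have hmeas := S.measurable.iterate n
  have hmass : m.real (T^[n] ⁻¹' E) = ∫ x in E, g x ∂m := by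
    have hind (x : X) : |E.indicator (1 : X → ℝ) x| ≤ 1 := by
      by_cases hx : x ∈ E <;> simp [hx]
    have := h (E.indicator 1) (measurable_one.indicator hE) ⟨1, hind⟩
    simp only [mul_one] at this
    rw [← integral_indicator_one (hmeas hE), ← integral_indicator hE]
    refine this.trans (integral_congr_ae (.of_forall fun x => ?_))
    by_cases hx : x ∈ E <;> simp [hx]
  have hreal : m.real (T^[n] ⁻¹' E) ≤ C * m.real E := by
    rw [hmass]
    refine (setIntegral_mono hg.integrable.integrableOn (integrable_const C) hgC).trans_eq ?_
    simp [mul_comm]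
  rw [Measure.map_apply hmeas hE, Measure.smul_apply, smul_eq_mul, ← ofReal_measureReal,
    ← ofReal_measureReal, ← ENNReal.ofReal_mul (Real.exp_nonneg _)]
  exact ENNReal.ofReal_le_ofReal hreal

theorem abs_integral_comp_iterate_mul_sub_integral_le_of_lipschitzWith {u : X → ℝ}
    (hu : Measurable u) (hu1 : ∀ x, |u x| ≤ 1) (n : ℕ) {K : ℝ≥0} {φ : X → ℝ}
    (hφ : LipschitzWith K φ) :
    |∫ x, u (T^[n] x) * (φ x - ∫ y, φ y ∂m) ∂m| ≤
      2 * (Metric.diam (univ : Set X) + a⁻¹) * K * coneRate X a b ^ n := by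
  have ha := S.left_pos
  set D := Metric.diam (univ : Set X)
  set c : ℝ := K * (D + a⁻¹) with hc
  have hc0 : 0 ≤ c := mul_nonneg K.2 (add_nonneg Metric.diam_nonneg (inv_nonneg.2 ha.le))
  have hφi : Integrable φ m := hφ.continuous.integrable_of_hasCompactSupport (.of_compactSpace φ)
  have hf : LogLipschitzWith a fun x => φ x - ∫ y, φ y ∂m + c :=
    .sub_integral_add_const hφ ha
  have hmass : ∫ x, (φ x - ∫ y, φ y ∂m + c) ∂m = c := by
    rw [integral_add (by exact hφi.sub (integrable_const _)) (integrable_const c),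
      integral_sub hφi (integrable_const _)]
    simp
  have := S.abs_integral_comp_iterate_mul_sub_le hu hu1 n hf (.const ha.le hc0)
    (by simpa using hmass)
  rw [hmass, ← integral_sub] at this
  · refine (le_of_eq ?_).trans (this.trans_eq (by rw [hc]; ring))
    congr with x
    ring
  all_goals
    refine Integrable.bdd_mul (c := 1) ?_
      (hu.comp (S.measurable.iterate n)).aestronglyMeasurable (.of_forall fun x => hu1 _)
  exacts [hf.integrable, integrable_const c]

theorem eventually_abs_integral_comp_iterate_mul_sub_integral_le {φ : X → ℝ}
    (hφ : Integrable φ m) {ε : ℝ} (hε : 0 < ε) :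
    ∀ᶠ n in atTop, ∀ u : X → ℝ, Measurable u → (∀ x, |u x| ≤ 1) →
      |∫ x, u (T^[n] x) * (φ x - ∫ y, φ y ∂m) ∂m| ≤ ε := by
  obtain ⟨ψ, K, hK, hψ, hle⟩ := exists_lipschitzWith_integral_abs_sub_le hφ (div_pos hε four_pos)
  have hdecay : Tendsto
      (fun n => 2 * (Metric.diam (univ : Set X) + a⁻¹) * K * coneRate X a b ^ n) atTop (𝓝 0) := by
    simpa using (tendsto_pow_atTop_nhds_zero_of_lt_one S.coneRate_pos.le
      S.coneRate_lt_one).const_mul (2 * (Metric.diam (univ : Set X) + a⁻¹) * K)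
  filter_upwards [hdecay.eventually_lt_const (half_pos hε)] with n hn u hu hu1
  have := S.abs_integral_comp_iterate_mul_sub_integral_le_of_lipschitzWith hu hu1 n hK
  have := abs_integral_mul_sub_integral_sub_le (hu.comp (S.measurable.iterate n))
    (fun x => hu1 (T^[n] x)) hφ hψ
  rw [abs_le] at *
  simp only [Function.comp_apply] at this
  constructor <;> linarith

end ContractsCone

end Cone

section Periodic

theorem lipschitzWith_coe_unitAddCircle : LipschitzWith 1 ((↑) : ℝ → UnitAddCircle) :=
  .of_dist_le_mul fun x y => by
    rw [dist_eq_norm, dist_eq_norm, ← AddCircle.coe_sub, NNReal.coe_one, one_mul]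
    exact QuotientAddGroup.norm_mk_le_norm

theorem exists_coe_eq_dist_eq (x y : UnitAddCircle) :
    ∃ s t : ℝ, (s : UnitAddCircle) = x ∧ (t : UnitAddCircle) = y ∧ dist s t = dist x y := by
  obtain ⟨s, rfl⟩ := QuotientAddGroup.mk_surjective x
  obtain ⟨t, rfl⟩ := QuotientAddGroup.mk_surjective y
  refine ⟨s, t + round (s - t), rfl, ?_, ?_⟩
  · simp
  · rw [dist_eq_norm, dist_eq_norm, ← QuotientAddGroup.mk_sub]
    exact .symm <| (UnitAddCircle.norm_eq (x := s - t)).trans <| by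
      rw [Real.norm_eq_abs, sub_sub]

theorem LogLipschitzWith.periodic_lift {b : ℝ} {h : ℝ → ℝ} (hh : LogLipschitzWith b h)
    (hper : Function.Periodic h 1) : LogLipschitzWith b hper.lift where
  nonneg x := by
    obtain ⟨s, rfl⟩ := QuotientAddGroup.mk_surjective x
    exact hh.nonneg s
  le_exp_mul x y := by
    obtain ⟨s, t, rfl, rfl, hst⟩ := exists_coe_eq_dist_eq x y
    rw [← hst]
    exact hh.le_exp_mul s t

theorem periodic_sum_range_comp_add {h : ℝ → ℝ} {d : ℕ} (hh : Function.Periodic h d) :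
    Function.Periodic (fun y => ∑ k ∈ Finset.range d, h (y + k)) 1 := fun y => by
  have hshift (k : ℕ) : h (y + 1 + k) = h (y + (k + 1 : ℕ)) := by
    push_cast
    ring_nf
  have htelescope := (Finset.sum_range_succ' (fun k : ℕ => h (y + k)) d).symm.trans
    (Finset.sum_range_succ _ d)
  rw [Nat.cast_zero, add_zero, hh y] at htelescope
  simpa only [hshift] using add_right_cancel htelescope

theorem integral_add_natCast_eq_sum {F : ℝ → ℝ} (p : ℝ) (d : ℕ)
    (hF : ∀ a b, IntervalIntegrable F volume a b) :
    ∫ y in p..p + d, F y = ∑ k ∈ Finset.range d, ∫ y in p..p + 1, F (y + k) := by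
  have := intervalIntegral.sum_integral_adjacent_intervals (μ := volume) (f := F) (n := d)
    (a := fun k => p + k) fun k _ => hF _ _
  simp only [Nat.cast_zero, add_zero] at this
  rw [← this]
  refine Finset.sum_congr rfl fun k _ => ?_
  rw [intervalIntegral.integral_comp_add_right]
  push_cast
  ring_nf

end Periodic

/-- `τ` is an orientation preserving lift of the expanding map `T` of the circle, of degree `d`,
expanding by a factor at least `lam`, with `B`-Lipschitz derivative. -/
structure ExpandingLift (T : UnitAddCircle → UnitAddCircle) (τ : ℝ → ℝ) (d : ℕ) (lam : ℝ)
    (B : ℝ≥0) : Prop where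
  coe_apply : ∀ x : ℝ, (τ x : UnitAddCircle) = T x
  differentiable : Differentiable ℝ τ
  add_one : ∀ x, τ (x + 1) = τ x + d
  one_lt : 1 < lam
  le_deriv : ∀ x, lam ≤ deriv τ x
  lipschitzWith_deriv : LipschitzWith B (deriv τ)

namespace ExpandingLift

variable {T : UnitAddCircle → UnitAddCircle} {τ : ℝ → ℝ} {d : ℕ} {lam : ℝ} {B : ℝ≥0}
  (L : ExpandingLift T τ d lam B)

include L

theorem continuous : Continuous T := by
  refine (QuotientAddGroup.isQuotientMap_mk (AddSubgroup.zmultiples (1 : ℝ))).continuous_iff.2 ?_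
  refine Continuous.congr (AddCircle.continuous_mk' 1 |>.comp L.differentiable.continuous) ?_
  exact L.coe_apply

theorem mul_sub_le {x y : ℝ} (hxy : x ≤ y) : lam * (y - x) ≤ τ y - τ x :=
  mul_sub_le_image_sub_of_le_deriv L.differentiable L.le_deriv hxy

theorem lam_pos : 0 < lam := one_pos.trans L.one_lt

theorem strictMono : StrictMono τ :=
  strictMono_of_deriv_pos fun x => L.lam_pos.trans_le (L.le_deriv x)

theorem surjective : Function.Surjective τ := by
  refine L.differentiable.continuous.surjective ?_ ?_
  · refine tendsto_atTop_mono' _ ?_ (tendsto_atTop_add_const_left _ (τ 0) tendsto_id)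
    filter_upwards [eventually_ge_atTop 0] with x hx
    simp only [id]
    nlinarith [L.mul_sub_le hx, L.one_lt]
  · refine tendsto_atBot_mono' _ ?_ (tendsto_atBot_add_const_left _ (τ 0) tendsto_id)
    filter_upwards [eventually_le_atBot 0] with x hx
    simp only [id]
    nlinarith [L.mul_sub_le hx, L.one_lt]

/-- The inverse of the lift `τ`. Its translates `y ↦ inverse (y + k)` lift the inverse branches of
`T`. -/
def inverse : ℝ → ℝ := Function.surjInv L.surjective

theorem apply_inverse (y : ℝ) : τ (L.inverse y) = y := Function.surjInv_eq L.surjective y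

theorem inverse_apply (x : ℝ) : L.inverse (τ x) = x :=
  L.strictMono.injective (L.apply_inverse (τ x))

theorem inverse_add_natCast (y : ℝ) : L.inverse (y + d) = L.inverse y + 1 := by
  rw [← L.inverse_apply (L.inverse y + 1), L.add_one, L.apply_inverse]

theorem lipschitzWith_inverse : LipschitzWith (Real.toNNReal lam⁻¹) L.inverse := by
  refine .of_le_add_mul _ fun x y => ?_
  rw [Real.coe_toNNReal _ (inv_nonneg.2 L.lam_pos.le), ← sub_le_iff_le_add',
    ← div_eq_inv_mul, le_div_iff₀' L.lam_pos]
  rcases le_total (L.inverse y) (L.inverse x) with h | h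
  · refine (L.mul_sub_le h).trans ?_
    rw [L.apply_inverse, L.apply_inverse]
    exact le_abs_self _
  · exact (mul_nonpos_of_nonneg_of_nonpos L.lam_pos.le (sub_nonpos.2 h)).trans dist_nonneg

/-- The contribution `f / τ'` of a lifted inverse branch to the transfer operator of `T`. -/
def branch (f : UnitAddCircle → ℝ) (y : ℝ) : ℝ :=
  f (L.inverse y) * (deriv τ (L.inverse y))⁻¹

theorem periodic_branch (f : UnitAddCircle → ℝ) : Function.Periodic (L.branch f) d := fun y => by
  have hderiv : deriv τ (L.inverse y + 1) = deriv τ (L.inverse y) := by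
    rw [← deriv_comp_add_const, funext L.add_one, deriv_add_const]
  rw [branch, branch, L.inverse_add_natCast, AddCircle.coe_add_period, hderiv]

theorem logLipschitzWith_inv_deriv : LogLipschitzWith B fun x => (deriv τ x)⁻¹ := by
  have h1 (x : ℝ) : 1 ≤ deriv τ x := L.one_lt.le.trans (L.le_deriv x)
  exact (LogLipschitzWith.of_lipschitzWith L.lipschitzWith_deriv (fun x => zero_le_one.trans (h1 x))
    fun x => le_mul_of_one_le_right B.2 (h1 x)).inv

theorem logLipschitzWith_branch {a : ℝ} (ha : 0 ≤ a) {f : UnitAddCircle → ℝ}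
    (hf : LogLipschitzWith a f) : LogLipschitzWith ((a + B) / lam) (L.branch f) := by
  have := ((hf.comp_lipschitzWith ha lipschitzWith_coe_unitAddCircle).mul
    L.logLipschitzWith_inv_deriv).comp_lipschitzWith (by positivity) L.lipschitzWith_inverse
  rwa [Real.coe_toNNReal _ (inv_nonneg.2 L.lam_pos.le), NNReal.coe_one, mul_one] at this

/-- The image of the density `f` under the transfer operator of `T`, a sum over the `d` inverse
branches. -/
def transferDensity (f : UnitAddCircle → ℝ) : UnitAddCircle → ℝ :=
  (periodic_sum_range_comp_add (L.periodic_branch f)).lift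

theorem logLipschitzWith_transferDensity {a : ℝ} (ha : 0 ≤ a) {f : UnitAddCircle → ℝ}
    (hf : LogLipschitzWith a f) : LogLipschitzWith ((a + B) / lam) (L.transferDensity f) := by
  refine LogLipschitzWith.periodic_lift (.sum _ fun k _ => ?_) _
  have hshift : LipschitzWith 1 fun y : ℝ => y + k := .of_dist_le_mul fun x y => by simp
  have := (L.logLipschitzWith_branch ha hf).comp_lipschitzWith
    (div_nonneg (by positivity) L.lam_pos.le) hshift
  rwa [NNReal.coe_one, mul_one] at this

theorem continuous_branch {f : UnitAddCircle → ℝ} (hf : Continuous f) :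
    Continuous (L.branch f) :=
  (hf.comp ((AddCircle.continuous_mk' 1).comp L.lipschitzWith_inverse.continuous)).mul <|
    (L.lipschitzWith_deriv.continuous.comp L.lipschitzWith_inverse.continuous).inv₀ fun _ =>
      (L.lam_pos.trans_le (L.le_deriv _)).ne'

theorem isTransferDensity_transferDensity {f : UnitAddCircle → ℝ} (hf : Continuous f) :
    IsTransferDensity volume T f (L.transferDensity f) := by
  intro u hu ⟨C, hC⟩
  set F : ℝ → ℝ := fun y => u y * L.branch f y with hF
  have hFi (p q : ℝ) : IntervalIntegrable F volume p q := by
    rw [intervalIntegrable_iff]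
    exact (L.continuous_branch hf).integrableOn_uIoc.bdd_mul
      (hu.comp (AddCircle.measurable_mk' (a := 1))).aestronglyMeasurable (.of_forall fun y => hC y)
  calc ∫ x, u (T x) * f x
      = ∫ x in (0 : ℝ)..0 + 1, u (T x) * f x :=
        (UnitAddCircle.intervalIntegral_preimage 0 fun x => u (T x) * f x).symm
    _ = ∫ x in (0 : ℝ)..0 + 1, (F ∘ τ) x * deriv τ x := by
        refine intervalIntegral.integral_congr fun x _ => ?_
        have : deriv τ x ≠ 0 := (L.lam_pos.trans_le (L.le_deriv x)).ne'
        simp only [hF, Function.comp_apply, branch, L.inverse_apply, L.coe_apply]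
        field_simp
    _ = ∫ y in τ 0..τ 0 + d, F y := by
        rw [intervalIntegral.integral_comp_mul_deriv_of_deriv_nonneg
          L.differentiable.continuous.continuousOn (fun x _ => (L.differentiable x).hasDerivAt)
          fun x _ => L.lam_pos.le.trans (L.le_deriv x), L.add_one]
    _ = ∫ y in τ 0..τ 0 + 1, ∑ k ∈ Finset.range d, F (y + k) := by
        rw [integral_add_natCast_eq_sum _ _ hFi, intervalIntegral.integral_finsetSum]
        intro k _
        simpa using (hFi (τ 0 + k) (τ 0 + 1 + k)).comp_add_right k
    _ = ∫ y in τ 0..τ 0 + 1, u y * L.transferDensity f y := by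
        refine intervalIntegral.integral_congr fun y _ => ?_
        have hy (k : ℕ) : ((y + k : ℝ) : UnitAddCircle) = y := by
          rw [AddCircle.coe_add, ← nsmul_one k, AddCircle.coe_nsmul, AddCircle.coe_period,
            nsmul_zero, add_zero]
        simp only [hF, hy, ← Finset.mul_sum, transferDensity, Function.Periodic.lift_coe]
    _ = ∫ x, u x * L.transferDensity f x :=
        UnitAddCircle.intervalIntegral_preimage _ fun x => u x * L.transferDensity f x

/-- The constant `a = (B + 1) / (lam - 1)` is chosen to make `(a + B) / lam < a`. -/
theorem contractsCone : ContractsCone (volume : Measure UnitAddCircle) T ((B + 1) / (lam - 1))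
    (((B + 1) / (lam - 1) + B) / lam) where
  measurable := L.continuous.measurable
  right_pos := by
    have := sub_pos.2 L.one_lt
    have := L.lam_pos
    positivity
  right_lt_left := by
    have := sub_pos.2 L.one_lt
    rw [div_lt_iff₀ L.lam_pos, ← sub_pos]
    have : (B + 1 : ℝ) / (lam - 1) * lam - ((B + 1) / (lam - 1) + B) = 1 := by
      field_simp
      ring
    exact this.symm ▸ one_pos
  exists_isTransferDensity f hf :=
    have ha : (0 : ℝ) ≤ (B + 1) / (lam - 1) :=
      div_nonneg (by positivity) (sub_nonneg.2 L.one_lt.le)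
    ⟨L.transferDensity f, L.logLipschitzWith_transferDensity ha hf,
      L.isTransferDensity_transferDensity hf.continuous⟩

end ExpandingLift

theorem exists_int_add_one_eq {T : UnitAddCircle → UnitAddCircle} {τ : ℝ → ℝ}
    (hτ : Continuous τ) (hT : ∀ x : ℝ, (τ x : UnitAddCircle) = T x) :
    ∃ d : ℤ, ∀ x, τ (x + 1) = τ x + d := by
  have hint (x : ℝ) : ∃ d : ℤ, (d : ℝ) = τ (x + 1) - τ x := by
    have h : ((τ (x + 1) - τ x : ℝ) : UnitAddCircle) = 0 := by
      rw [AddCircle.coe_sub, hT, hT, AddCircle.coe_add_period, sub_self]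
    obtain ⟨n, hn⟩ := (AddCircle.coe_eq_zero_iff (1 : ℝ)).1 h
    exact ⟨n, by simpa using hn⟩
  choose d hd using hint
  have hd_cont : Continuous d := by
    refine Int.isClosedEmbedding_coe_real.isEmbedding.continuous_iff.2 ?_
    refine Continuous.congr (f := fun x => τ (x + 1) - τ x) (by fun_prop) fun x => (hd x).symm
  refine ⟨d 0, fun x => ?_⟩
  rw [← PreconnectedSpace.constant inferInstance hd_cont (x := x), hd, add_sub_cancel]

theorem exists_expandingLift {T : UnitAddCircle → UnitAddCircle} {τ : ℝ → ℝ} (hτ : ContDiff ℝ 2 τ)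
    (hT : ∀ x : ℝ, (τ x : UnitAddCircle) = T x) (hderiv : ∀ x, 1 < deriv τ x) :
    ∃ d lam B, ExpandingLift T τ d lam B := by
  have hdiff : Differentiable ℝ τ := hτ.differentiable two_ne_zero
  have hτ' : ContDiff ℝ 1 (deriv τ) := (contDiff_succ_iff_deriv.1 hτ).2.2
  obtain ⟨d, hd⟩ := exists_int_add_one_eq hτ.continuous hT
  have hmono : StrictMono τ := strictMono_of_deriv_pos fun x => one_pos.trans (hderiv x)
  have hd0 : 0 ≤ d := by
    have : τ 0 < τ 0 + d := by simpa only [hd 0] using hmono (lt_add_one (0 : ℝ))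
    exact_mod_cast (lt_add_iff_pos_right _).1 this |>.le
  lift d to ℕ using hd0
  have hper : Function.Periodic (deriv τ) 1 := fun x => by
    rw [← deriv_comp_add_const, funext hd, deriv_add_const]
  have hper' : Function.Periodic (deriv (deriv τ)) 1 := fun x => by
    rw [← deriv_comp_add_const, funext hper]
  obtain ⟨_, ⟨x₀, rfl⟩, hmin⟩ := (hper.compact_of_continuous one_ne_zero
    hτ'.continuous).exists_isLeast (range_nonempty _)
  obtain ⟨B, hB⟩ := (hper'.compact_of_continuous one_ne_zero
    (hτ'.continuous_deriv le_rfl)).isBounded.exists_norm_le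
  exact ⟨d, deriv τ x₀, B.toNNReal, hT, hdiff, by simpa using hd, hderiv x₀,
    fun x => hmin ⟨x, rfl⟩, lipschitzWith_of_nnnorm_deriv_le (hτ'.differentiable one_ne_zero)
      fun x => NNReal.le_toNNReal_of_coe_le (hB _ ⟨x, rfl⟩)⟩

theorem ContractsCone.comp_isometryEquiv {X : Type*} [PseudoMetricSpace X] [MeasurableSpace X]
    [BorelSpace X] {m : Measure X} {T : X → X} {a b : ℝ} (S : ContractsCone m T a b) (e : X ≃ᵢ X)
    (he : MeasurePreserving e m m) : ContractsCone m (T ∘ e) a b where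
  measurable := S.measurable.comp e.continuous.measurable
  right_pos := S.right_pos
  right_lt_left := S.right_lt_left
  exists_isTransferDensity f hf := by
    obtain ⟨g, hg, hfg⟩ := S.exists_isTransferDensity (f ∘ e.symm) (by
      simpa using hf.comp_lipschitzWith S.left_pos.le e.symm.isometry.lipschitz)
    refine ⟨g, hg, fun u hu hC => ?_⟩
    have := he.integral_comp e.toHomeomorph.measurableEmbedding fun x => u (T x) * f (e.symm x)
    rw [← hfg u hu hC]
    simpa using this

theorem forall_lt_or_forall_lt_neg {X : Type*} [TopologicalSpace X] [PreconnectedSpace X]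
    {f : X → ℝ} (hf : Continuous f) {c : ℝ} (hc : 0 ≤ c) (h : ∀ x, c < |f x|) :
    (∀ x, c < f x) ∨ ∀ x, f x < -c := by
  by_contra! ⟨⟨x, hx⟩, ⟨y, hy⟩⟩
  have hx' := (lt_abs.1 (h x)).resolve_left hx.not_gt
  have hy' := (lt_abs.1 (h y)).resolve_right (by linarith)
  obtain ⟨z, hz⟩ := mem_range_of_exists_le_of_exists_ge hf ⟨x, by linarith⟩ ⟨y, hc.trans hy'.le⟩
  exact (h z).not_ge (by simpa [hz] using hc)

theorem IsExpandingMap.continuous_and_exists_contractsCone {T : UnitAddCircle → UnitAddCircle}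
    (hT : IsExpandingMap T) : Continuous T ∧ ∃ a b, ContractsCone volume T a b := by
  obtain ⟨τ, hτ, hτT, hexp⟩ := hT
  rcases forall_lt_or_forall_lt_neg (hτ.continuous_deriv one_le_two) zero_le_one hexp with
    hpos | hneg
  · obtain ⟨d, lam, B, L⟩ := exists_expandingLift hτ hτT hpos
    exact ⟨L.continuous, _, _, L.contractsCone⟩
  · obtain ⟨d, lam, B, L⟩ := exists_expandingLift (T := T ∘ Neg.neg) (τ := τ ∘ Neg.neg)
      (hτ.comp contDiff_neg) (fun x => by simp [hτT]) fun x => by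
        have : deriv (τ ∘ Neg.neg) x = -deriv τ (-x) := deriv_comp_neg τ x
        linarith [hneg (-x)]
    have hcomp : (T ∘ Neg.neg) ∘ IsometryEquiv.neg UnitAddCircle = T := by
      ext x
      simp
    exact ⟨hcomp ▸ L.continuous.comp (IsometryEquiv.neg _).continuous, _, _,
      hcomp ▸ L.contractsCone.comp_isometryEquiv (.neg _) (Measure.measurePreserving_neg _)⟩

section Sobolev

instance : IsProbabilityMeasure (volume : Measure UnitAddCircle) := ⟨UnitAddCircle.measure_univ⟩

variable {f f' g : UnitAddCircle → ℝ} {δ : ℝ}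

theorem periodic_comp_coe (g : UnitAddCircle → ℝ) : Function.Periodic (fun t : ℝ => g t) 1 :=
  fun t => congrArg g (AddCircle.coe_add_period 1 t)

theorem intervalIntegrable_comp_coe (hg : Integrable g) (x y : ℝ) :
    IntervalIntegrable (fun t : ℝ => g t) volume x y := by
  refine (periodic_comp_coe g).intervalIntegrable one_ne_zero (t := 0) ?_ x y
  rw [intervalIntegrable_iff_integrableOn_Ioc_of_le (by simp)]
  exact (UnitAddCircle.measurePreserving_mk 0).integrable_comp_of_integrable hg

theorem HasL1Deriv.sub_eq_integral (h : HasL1Deriv f f') (x y : ℝ) :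
    f y - f x = ∫ t in x..y, f' t := by
  have hi := intervalIntegrable_comp_coe h.1
  have hf'0 : ∫ t in (0 : ℝ)..0 + 1, f' t = 0 := by
    have h1 : ((1 : ℝ) : UnitAddCircle) = 0 := AddCircle.coe_period 1
    simpa [h1] using h.2 1 (right_mem_Icc.2 zero_le_one)
  have hper : Function.Periodic (fun x : ℝ => f x - ∫ t in (0 : ℝ)..x, f' t) 1 := fun x => by
    simp only
    rw [AddCircle.coe_add_period, ← intervalIntegral.integral_add_adjacent_intervals
      (hi 0 x) (hi x (x + 1)), (periodic_comp_coe f').intervalIntegral_add_eq x 0, hf'0, add_zero]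
  have hconst (x : ℝ) : f x - ∫ t in (0 : ℝ)..x, f' t = f 0 := by
    obtain ⟨z, hz, hxz⟩ := hper.exists_mem_Ico₀ one_pos x
    rw [hxz, sub_eq_iff_eq_add]
    exact h.2 z ⟨hz.1, hz.2.le⟩
  rw [← intervalIntegral.integral_interval_sub_left (hi 0 y) (hi 0 x)]
  linarith [hconst x, hconst y]

theorem HasL1Deriv.continuous_comp_coe (h : HasL1Deriv f f') : Continuous fun x : ℝ => f x := by
  refine ((intervalIntegral.continuous_primitive (intervalIntegrable_comp_coe h.1) 0).add
    (continuous_const (y := f (0 : ℝ)))).congr fun x => ?_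
  simp only [Pi.add_apply, ← h.sub_eq_integral, sub_add_cancel]

theorem HasL1Deriv.continuous (h : HasL1Deriv f f') : Continuous f :=
  (QuotientAddGroup.isQuotientMap_mk (AddSubgroup.zmultiples (1 : ℝ))).continuous_iff.2
    h.continuous_comp_coe

theorem continuous_intervalIntegral_comp_coe (hg : Integrable g) (δ : ℝ) :
    Continuous fun x : ℝ => ∫ t in x..x + δ, g t := by
  have hi := intervalIntegrable_comp_coe hg
  have hΦ := intervalIntegral.continuous_primitive hi 0
  refine ((hΦ.comp (continuous_add_const δ)).sub hΦ).congr fun x => ?_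
  exact intervalIntegral.integral_interval_sub_left (hi 0 _) (hi 0 x)

theorem HasL1Deriv.abs_sub_le (h : HasL1Deriv f f') {x y : ℝ} (hxy : x ≤ y) :
    |f y - f x| ≤ ∫ t in x..y, |f' t| := by
  rw [h.sub_eq_integral]
  exact intervalIntegral.abs_integral_le_integral_abs hxy

theorem intervalIntegral_comp_coe_mono (hg : Integrable g) (hg0 : 0 ≤ g) {x y z : ℝ}
    (hxy : x ≤ y) (hyz : y ≤ z) : ∫ t in x..y, g t ≤ ∫ t in x..z, g t :=
  intervalIntegral.integral_mono_interval le_rfl hxy hyz (.of_forall fun t => hg0 t)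
    (intervalIntegrable_comp_coe hg x z)

/-- The Steklov average of `f` over windows of length `δ`, which regularizes `f`. -/
def steklovMean (δ : ℝ) (f : UnitAddCircle → ℝ) (x : UnitAddCircle) : ℝ :=
  δ⁻¹ * ∫ t in (0 : ℝ)..δ, f (x + t)

theorem steklovMean_coe (δ : ℝ) (f : UnitAddCircle → ℝ) (x : ℝ) :
    steklovMean δ f x = δ⁻¹ * ∫ t in x..x + δ, f t := by
  have := intervalIntegral.integral_comp_add_left (fun t : ℝ => f t) x (a := 0) (b := δ)
  simp only [AddCircle.coe_add, add_zero] at this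
  rw [steklovMean, this]

theorem lipschitzWith_steklovMean (h : HasL1Deriv f f') (hδ : 0 < δ) (hδ1 : δ ≤ 1) :
    LipschitzWith (δ⁻¹ * ∫ x, |f' x|).toNNReal (steklovMean δ f) := by
  have hf (x y : ℝ) : IntervalIntegrable (fun t : ℝ => f t) volume x y :=
    h.continuous_comp_coe.intervalIntegrable x y
  have hf_shift (x y : ℝ) : IntervalIntegrable (fun t : ℝ => f (t + δ : ℝ)) volume x y :=
    (h.continuous_comp_coe.comp (continuous_add_const δ)).intervalIntegrable x y
  have : 0 ≤ ∫ x, |f' x| := integral_nonneg fun x => abs_nonneg _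
  have hosc (t : ℝ) : |f (t + δ : ℝ) - f t| ≤ ∫ x, |f' x| :=
    calc |f (t + δ : ℝ) - f t| ≤ ∫ s in t..t + δ, |f' s| := h.abs_sub_le (by linarith)
      _ ≤ ∫ s in t..t + 1, |f' s| := intervalIntegral_comp_coe_mono h.1.abs
          (fun x => abs_nonneg _) (by linarith) (by linarith)
      _ = ∫ x, |f' x| := UnitAddCircle.intervalIntegral_preimage t fun x => |f' x|
  refine .of_dist_le_mul fun x y => ?_
  obtain ⟨s, t, rfl, rfl, hst⟩ := exists_coe_eq_dist_eq x y
  have hdiff : steklovMean δ f s - steklovMean δ f t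
      = δ⁻¹ * ∫ r in t..s, (f (r + δ : ℝ) - f r) := by
    have := intervalIntegral.integral_interval_sub_interval_comm (hf s (s + δ)) (hf t (t + δ))
      (hf s t)
    rw [steklovMean_coe, steklovMean_coe, intervalIntegral.integral_sub (hf_shift t s) (hf t s),
      intervalIntegral.integral_comp_add_right (fun r : ℝ => f r), ← mul_sub, this,
      intervalIntegral.integral_symm t s, intervalIntegral.integral_symm (t + δ) (s + δ)]
    ring
  rw [← hst, Real.dist_eq, hdiff, abs_mul, abs_of_pos (inv_pos.2 hδ),
    Real.coe_toNNReal _ (by positivity), mul_assoc, Real.dist_eq]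
  gcongr
  exact intervalIntegral.norm_integral_le_of_norm_le_const (E := ℝ) fun r _ => hosc r

theorem integral_intervalIntegral_add_comp_coe (hg : Integrable g) (δ : ℝ) :
    ∫ x in (0 : ℝ)..1, ∫ t in x..x + δ, g t = δ * ∫ x, g x := by
  set Φ : ℝ → ℝ := fun x => ∫ t in (0 : ℝ)..x, g t
  have hi := intervalIntegrable_comp_coe hg
  have hΦ : Continuous Φ := intervalIntegral.continuous_primitive hi 0
  have hΦi := hΦ.intervalIntegrable (μ := volume)
  have hΦ_shift (c x y : ℝ) : IntervalIntegrable (fun t => Φ (t + c)) volume x y :=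
    (hΦ.comp (continuous_add_const c)).intervalIntegrable x y
  have hΦ_sub (x y : ℝ) : ∫ t in x..y, g t = Φ y - Φ x :=
    (intervalIntegral.integral_interval_sub_left (hi 0 y) (hi 0 x)).symm
  calc ∫ x in (0 : ℝ)..1, ∫ t in x..x + δ, g t
      = (∫ x in δ..1 + δ, Φ x) - ∫ x in (0 : ℝ)..1, Φ x := by
        simp only [hΦ_sub]
        rw [intervalIntegral.integral_sub (hΦ_shift δ 0 1) (hΦi 0 1),
          intervalIntegral.integral_comp_add_right, zero_add]
    _ = (∫ x in (0 : ℝ)..δ, Φ (x + 1)) - ∫ x in (0 : ℝ)..δ, Φ x := by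
        rw [intervalIntegral.integral_comp_add_right, zero_add, add_comm δ 1,
          intervalIntegral.integral_interval_sub_interval_comm (hΦi δ _) (hΦi 0 1) (hΦi δ 0),
          intervalIntegral.integral_symm 0 δ, intervalIntegral.integral_symm 1 (1 + δ)]
        ring
    _ = δ * ∫ x, g x := by
        rw [← intervalIntegral.integral_sub (hΦ_shift 1 0 δ) (hΦi 0 δ)]
        simp [← hΦ_sub, UnitAddCircle.intervalIntegral_preimage _ g]

theorem abs_steklovMean_sub_le (h : HasL1Deriv f f') (hδ : 0 < δ) (x : ℝ) :
    |steklovMean δ f x - f x| ≤ ∫ t in x..x + δ, |f' t| := by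
  have hmean : steklovMean δ f x - f x = δ⁻¹ * ∫ t in x..x + δ, (f t - f x) := by
    rw [steklovMean_coe, intervalIntegral.integral_sub
      (h.continuous_comp_coe.intervalIntegrable _ _) intervalIntegrable_const,
      intervalIntegral.integral_const, add_sub_cancel_left, smul_eq_mul, mul_sub,
      inv_mul_cancel_left₀ hδ.ne']
  have hle : |∫ t in x..x + δ, (f t - f x)| ≤ (∫ t in x..x + δ, |f' t|) * |x + δ - x| := by
    refine intervalIntegral.norm_integral_le_of_norm_le_const (E := ℝ) fun t ht => ?_
    rw [uIoc_of_le (by linarith)] at ht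
    exact (h.abs_sub_le ht.1.le).trans
      (intervalIntegral_comp_coe_mono h.1.abs (fun x => abs_nonneg _) ht.1.le ht.2)
  rw [hmean, abs_mul, abs_of_pos (inv_pos.2 hδ), inv_mul_le_iff₀ hδ, mul_comm]
  simpa [abs_of_pos hδ] using hle

theorem integral_abs_sub_steklovMean_le (h : HasL1Deriv f f') (hδ : 0 < δ) (hδ1 : δ ≤ 1) :
    ∫ x, |f x - steklovMean δ f x| ≤ δ * ∫ x, |f' x| := by
  have hcont : Continuous fun x => |f x - steklovMean δ f x| :=
    (h.continuous.sub (lipschitzWith_steklovMean h hδ hδ1).continuous).abs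
  calc ∫ x, |f x - steklovMean δ f x|
      = ∫ x in (0 : ℝ)..1, |f x - steklovMean δ f x| := by
        rw [← UnitAddCircle.intervalIntegral_preimage 0, zero_add]
    _ ≤ ∫ x in (0 : ℝ)..1, ∫ t in x..x + δ, |f' t| := by
        refine intervalIntegral.integral_mono zero_le_one
          ((hcont.comp (AddCircle.continuous_mk' 1)).intervalIntegrable 0 1)
          ((continuous_intervalIntegral_comp_coe h.1.abs δ).intervalIntegrable 0 1) fun x => ?_
        rw [abs_sub_comm]
        exact abs_steklovMean_sub_le h hδ x
    _ = δ * ∫ x, |f' x| := integral_intervalIntegral_add_comp_coe h.1.abs δ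

end Sobolev

theorem ContractsCone.abs_integral_comp_iterate_mul_sub_integral_le_of_hasL1Deriv
    {T : UnitAddCircle → UnitAddCircle} {a b : ℝ} (S : ContractsCone volume T a b)
    {u f f' : UnitAddCircle → ℝ} (hu : Measurable u) (hu1 : ∀ x, |u x| ≤ 1)
    (h : HasL1Deriv f f') (n : ℕ) :
    |∫ x, u (T^[n] x) * (f x - ∫ y, f y)| ≤
      2 * (Metric.diam (univ : Set UnitAddCircle) + a⁻¹ + 1) * √(coneRate UnitAddCircle a b) ^ n *
        ∫ x, |f' x| := by
  set θ := coneRate UnitAddCircle a b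
  set δ := √θ ^ n
  have hθ : 0 < θ := S.coneRate_pos
  have hδ : 0 < δ := pow_pos (Real.sqrt_pos.2 hθ) n
  have hδ1 : δ ≤ 1 := pow_le_one₀ (Real.sqrt_nonneg θ) (Real.sqrt_le_one.2 S.coneRate_lt_one.le)
  have hθδ : θ ^ n = δ * δ := by rw [← mul_pow, Real.mul_self_sqrt hθ.le]
  have : 0 ≤ ∫ x, |f' x| := integral_nonneg fun x => abs_nonneg _
  have hL := lipschitzWith_steklovMean h hδ hδ1
  have hsmooth := S.abs_integral_comp_iterate_mul_sub_integral_le_of_lipschitzWith hu hu1 n hL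
  have hclose := abs_integral_mul_sub_integral_sub_le (m := volume)
    (hu.comp (S.measurable.iterate n)) (fun x => hu1 _)
    (h.continuous.integrable_of_hasCompactSupport (.of_compactSpace f))
    (hL.continuous.integrable_of_hasCompactSupport (.of_compactSpace _))
  have hL1 := integral_abs_sub_steklovMean_le h hδ hδ1
  rw [Real.coe_toNNReal _ (by positivity), hθδ] at hsmooth
  simp only [Function.comp_apply] at hclose
  calc |∫ x, u (T^[n] x) * (f x - ∫ y, f y)|
      ≤ 2 * (δ * ∫ x, |f' x|) +
          2 * (Metric.diam (univ : Set UnitAddCircle) + a⁻¹) * (δ⁻¹ * ∫ x, |f' x|) * (δ * δ) := by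
        rw [← sub_add_cancel (∫ x, u (T^[n] x) * (f x - ∫ y, f y))]
        refine (abs_add_le _ _).trans (add_le_add (hclose.trans ?_) hsmooth)
        gcongr
    _ = 2 * (Metric.diam (univ : Set UnitAddCircle) + a⁻¹ + 1) * δ * ∫ x, |f' x| := by
        field_simp
        ring

section AbsolutelyContinuousMarginal

variable {μ ν : SignedMeasure SolidTorus}

instance {X : Type*} [MeasurableSpace X] (μ : SignedMeasure X) : IsFiniteMeasure μ.variation :=
  μ.totalVariation_eq_variation ▸ inferInstance

theorem isAB_iff : IsAB μ ↔ μ.variation.fst ≪ volume := by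
  rw [← μ.totalVariation_eq_variation, SignedMeasure.totalVariation, Measure.fst,
    Measure.map_add _ _ measurable_fst, Measure.AbsolutelyContinuous.add_left_iff]
  rfl

theorem isAB_of_variation_le {ρ : Measure SolidTorus} (h : μ.variation ≤ ρ)
    (hρ : ρ.fst ≪ volume) : IsAB μ :=
  isAB_iff.2 ((Measure.map_mono h measurable_fst).absolutelyContinuous.trans hρ)

theorem isAB_toSignedMeasure {ρ : Measure SolidTorus} [IsFiniteMeasure ρ]
    (hρ : ρ.fst ≪ volume) : IsAB ρ.toSignedMeasure :=
  isAB_of_variation_le ρ.variation_toSignedMeasure.le hρ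

theorem IsAB.sub (hμ : IsAB μ) (hν : IsAB ν) : IsAB (μ - ν) := by
  refine isAB_of_variation_le VectorMeasure.variation_sub_le ?_
  rw [Measure.fst, Measure.map_add _ _ measurable_fst]
  exact (isAB_iff.1 hμ).add_left (isAB_iff.1 hν)

theorem IsAB.smul (hμ : IsAB μ) (c : ℝ) : IsAB (c • μ) := by
  refine isAB_of_variation_le VectorMeasure.variation_smul.le ?_
  rw [Measure.fst, Measure.map_smul]
  exact (isAB_iff.1 hμ).smul_left _

theorem integral_eq_integral_pos_sub_integral_neg (μ : SignedMeasure SolidTorus)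
    {h : SolidTorus → ℝ} (hh : Measurable h) {c : ℝ} (hc : ∀ p, |h p| ≤ c) :
    ∫ᵛ p, h p ∂<•μ = ∫ p, h p ∂pos μ - ∫ p, h p ∂neg μ := by
  have hi (ν : SignedMeasure SolidTorus) : ν.Integrable h :=
    .of_bound hh.aestronglyMeasurable c (.of_forall hc)
  rw [← VectorMeasure.integral_toSignedMeasure, ← VectorMeasure.integral_toSignedMeasure,
    ← VectorMeasure.integral_sub_vectorMeasure (hi _) (hi _)]
  exact congrArg (fun ν => ∫ᵛ p, h p ∂<•ν) μ.toSignedMeasure_toJordanDecomposition.symm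

theorem integrable_marginalDensity (μ : SignedMeasure SolidTorus) :
    Integrable (marginalDensity μ) :=
  Measure.integrable_toReal_rnDeriv.sub Measure.integrable_toReal_rnDeriv

theorem IsAB.integral_comp_fst (hμ : IsAB μ) {v : UnitAddCircle → ℝ} (hv : Measurable v) {c : ℝ}
    (hc : ∀ x, |v x| ≤ c) :
    ∫ᵛ p, v p.1 ∂<•μ = ∫ γ, v γ * marginalDensity μ γ := by
  have hdensity (ν : Measure SolidTorus) [IsFiniteMeasure ν] (hν : ν.fst ≪ volume) :
      ∫ p, v p.1 ∂ν = ∫ γ, v γ * (ν.fst.rnDeriv volume γ).toReal := by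
    rw [← integral_map measurable_fst.aemeasurable hv.aestronglyMeasurable]
    change ∫ γ, v γ ∂ν.fst = _
    simp only [← integral_rnDeriv_smul hν, smul_eq_mul, mul_comm]
  have hi (ν : Measure SolidTorus) [IsFiniteMeasure ν] :
      Integrable fun γ => v γ * (ν.fst.rnDeriv volume γ).toReal :=
    Measure.integrable_toReal_rnDeriv.bdd_mul hv.aestronglyMeasurable (.of_forall hc)
  rw [integral_eq_integral_pos_sub_integral_neg μ (h := fun p => v p.1) (by fun_prop)
      fun p => hc p.1,
    hdensity _ hμ.1, hdensity _ hμ.2, ← integral_sub (hi _) (hi _)]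
  simp only [marginalDensity, mul_sub]

theorem IsAB.integral_marginalDensity (hμ : IsAB μ) : ∫ γ, marginalDensity μ γ = μ univ := by
  simpa using (hμ.integral_comp_fst (v := fun _ => 1) measurable_const (c := 1) (by simp)).symm

end AbsolutelyContinuousMarginal

section Leaf

variable (ν : Measure SolidTorus) [IsFiniteMeasure ν] {h : SolidTorus → ℝ}

theorem ae_isFiniteMeasure_leaf : ∀ᵐ γ : UnitAddCircle, IsFiniteMeasure (leaf ν γ) := by
  filter_upwards [Measure.rnDeriv_lt_top ν.fst volume] with γ hγ
  refine ⟨?_⟩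
  rwa [leaf, Measure.smul_apply, measure_univ, smul_eq_mul, mul_one]

theorem measurable_integral_leaf (hh : Measurable h) :
    Measurable fun γ => ∫ y, h (γ, y) ∂(leaf ν γ) := by
  simp only [leaf, integral_smul_measure]
  exact (Measure.measurable_rnDeriv _ _).ennreal_toReal.smul
    hh.stronglyMeasurable.integral_kernel_prod_right'.measurable

variable {ν}

theorem integrable_integral_leaf (hν : ν.fst ≪ volume) (hh : Integrable h ν) :
    Integrable fun γ => ∫ y, h (γ, y) ∂(leaf ν γ) := by
  simp only [leaf, integral_smul_measure]
  exact (integrable_rnDeriv_smul_iff hν).2 hh.integral_condKernel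

theorem integral_integral_leaf (hν : ν.fst ≪ volume) (hh : Integrable h ν) :
    ∫ γ, ∫ y, h (γ, y) ∂(leaf ν γ) = ∫ p, h p ∂ν := by
  simp only [leaf, integral_smul_measure]
  rw [integral_rnDeriv_smul hν, Measure.integral_condKernel hh]

end Leaf

/-- The observables on the solid torus that are bounded by `c` and `c`-Lipschitz along the leaves,
with no regularity across the leaves besides measurability. For `c = 1` these are the test
functions computing `weakNorm` by duality. -/
structure IsLeafLipschitz (c : ℝ≥0) (h : SolidTorus → ℝ) : Prop where
  measurable : Measurable h
  abs_le : ∀ p, |h p| ≤ c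
  lipschitzWith : ∀ x, LipschitzWith c fun y => h (x, y)

/-- The pairing of a function on the solid torus with the restrictions `μ⁺|_γ` and `μ⁻|_γ`. -/
def leafPairing (μ : SignedMeasure SolidTorus) (h : SolidTorus → ℝ) (γ : UnitAddCircle) : ℝ :=
  ∫ y, h (γ, y) ∂(leaf (pos μ) γ) - ∫ y, h (γ, y) ∂(leaf (neg μ) γ)

theorem measurable_leafPairing (μ : SignedMeasure SolidTorus) {h : SolidTorus → ℝ}
    (hh : Measurable h) : Measurable (leafPairing μ h) :=
  (measurable_integral_leaf _ hh).sub (measurable_integral_leaf _ hh)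

namespace IsLeafLipschitz

variable {μ : SignedMeasure SolidTorus} {c : ℝ≥0} {g h : SolidTorus → ℝ}

protected theorem integrable (hh : IsLeafLipschitz c h) (ν : Measure SolidTorus)
    [IsFiniteMeasure ν] : Integrable h ν :=
  .of_bound hh.measurable.aestronglyMeasurable c (.of_forall hh.abs_le)

theorem inv_smul (hh : IsLeafLipschitz c h) (hc : c ≠ 0) :
    IsLeafLipschitz 1 fun p => (c : ℝ)⁻¹ * h p where
  measurable := hh.measurable.const_mul _
  abs_le p := by
    rw [abs_mul, abs_of_nonneg (by positivity), NNReal.coe_one,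
      inv_mul_le_iff₀ (by positivity), mul_one]
    exact hh.abs_le p
  lipschitzWith x := LipschitzWith.of_dist_le_mul fun y₁ y₂ => by
    rw [Real.dist_eq, ← mul_sub, abs_mul, abs_of_nonneg (by positivity), NNReal.coe_one,
      inv_mul_le_iff₀ (by positivity), one_mul]
    exact (hh.lipschitzWith x).dist_le_mul y₁ y₂

theorem integrable_leafPairing (hμ : IsAB μ) (hh : IsLeafLipschitz c h) :
    Integrable (leafPairing μ h) :=
  (integrable_integral_leaf hμ.1 (hh.integrable _)).sub
    (integrable_integral_leaf hμ.2 (hh.integrable _))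

theorem integral_leafPairing (hμ : IsAB μ) (hh : IsLeafLipschitz c h) :
    ∫ γ, leafPairing μ h γ = ∫ᵛ p, h p ∂<•μ := by
  rw [integral_eq_integral_pos_sub_integral_neg μ hh.measurable hh.abs_le,
    ← integral_integral_leaf hμ.1 (hh.integrable _),
    ← integral_integral_leaf hμ.2 (hh.integrable _)]
  exact integral_sub (integrable_integral_leaf hμ.1 (hh.integrable _))
    (integrable_integral_leaf hμ.2 (hh.integrable _))

theorem ofReal_abs_integral_le_weakNorm (hμ : IsAB μ) (hh : IsLeafLipschitz 1 h) :
    ENNReal.ofReal |∫ᵛ p, h p ∂<•μ| ≤ weakNorm μ := by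
  rw [← integral_leafPairing hμ hh, ← Real.norm_eq_abs, ofReal_norm]
  refine (enorm_integral_le_lintegral_enorm _).trans (lintegral_mono fun γ => ?_)
  rw [Real.enorm_eq_ofReal_abs]
  exact le_iSup₂_of_le (fun y => h (γ, y)) (hh.lipschitzWith γ)
    (le_iSup_of_le (fun y => hh.abs_le (γ, y)) le_rfl)

theorem abs_integral_le (hμ : μ ∈ spaceL1) (hh : IsLeafLipschitz c h) :
    |∫ᵛ p, h p ∂<•μ| ≤ c * (weakNorm μ).toReal := by
  rcases eq_or_ne c 0 with rfl | hc
  · have : h = fun _ => 0 := funext fun p => by simpa using hh.abs_le p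
    simp [this]
  have := (ENNReal.ofReal_le_iff_le_toReal hμ.2.ne).1
    ((hh.inv_smul hc).ofReal_abs_integral_le_weakNorm hμ.1)
  have hscale : ∫ᵛ p, (c : ℝ)⁻¹ * h p ∂<•μ = (c : ℝ)⁻¹ * ∫ᵛ p, h p ∂<•μ :=
    VectorMeasure.integral_fun_smul μ _ _ h
  rwa [hscale, abs_mul, abs_of_nonneg (by positivity), inv_mul_le_iff₀ (by positivity)] at this

/-- Leafwise Lipschitz functions can be glued along a measurable partition of the base: this is
where it matters that no regularity is required across the leaves. -/
theorem exists_leafPairing_eq_max (μ : SignedMeasure SolidTorus) (hg : IsLeafLipschitz c g)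
    (hh : IsLeafLipschitz c h) :
    ∃ k, IsLeafLipschitz c k ∧
      ∀ γ, leafPairing μ k γ = max (leafPairing μ g γ) (leafPairing μ h γ) := by
  classical
  set s : Set UnitAddCircle := {γ | leafPairing μ g γ ≤ leafPairing μ h γ}
  have hs : MeasurableSet s := measurableSet_le (measurable_leafPairing μ hg.measurable)
    (measurable_leafPairing μ hh.measurable)
  refine ⟨fun p => if p.1 ∈ s then h p else g p,
    ⟨.ite (measurable_fst hs) hh.measurable hg.measurable, fun p => ?_, fun γ => ?_⟩, fun γ => ?_⟩
  · split_ifs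
    exacts [hh.abs_le p, hg.abs_le p]
  · by_cases hγ : γ ∈ s
    · simpa only [hγ, if_true] using hh.lipschitzWith γ
    · simpa only [hγ, if_false] using hg.lipschitzWith γ
  · by_cases hγ : γ ∈ s
    · simpa only [leafPairing, hγ, if_true] using (max_eq_right hγ).symm
    · simpa only [leafPairing, hγ, if_false] using (max_eq_left (not_le.1 hγ).le).symm

theorem exists_leafPairing_eq_partialSups (μ : SignedMeasure SolidTorus)
    {g : ℕ → SolidTorus → ℝ} (hg : ∀ n, IsLeafLipschitz c (g n)) (n : ℕ) :
    ∃ h, IsLeafLipschitz c h ∧ leafPairing μ h = partialSups (fun i => leafPairing μ (g i)) n := by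
  induction n with
  | zero => exact ⟨g 0, hg 0, (partialSups_zero fun i => leafPairing μ (g i)).symm⟩
  | succ n ih =>
    obtain ⟨h, hh, heq⟩ := ih
    obtain ⟨k, hk, hmax⟩ := exists_leafPairing_eq_max μ hh (hg (n + 1))
    refine ⟨k, hk, ?_⟩
    rw [partialSups_add_one, ← heq]
    exact funext hmax

end IsLeafLipschitz

section Wasserstein

theorem exists_seq_wasserstein_le : ∃ g : ℕ → Disc → ℝ,
    (∀ n, LipschitzWith 1 (g n) ∧ ∀ y, |g n y| ≤ 1) ∧
      ∀ (ν₁ ν₂ : Measure Disc) [IsFiniteMeasure ν₁] [IsFiniteMeasure ν₂],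
        wasserstein ν₁ ν₂ ≤ ⨆ n, ENNReal.ofReal (∫ y, g n y ∂ν₁ - ∫ y, g n y ∂ν₂) := by
  let lipBall : Set C(Disc, ℝ) := {g | LipschitzWith 1 g ∧ ∀ y, |g y| ≤ 1}
  have : Nonempty lipBall := ⟨⟨0, LipschitzWith.const 0 |>.weaken zero_le_one, by simp⟩⟩
  obtain ⟨d, hd⟩ := TopologicalSpace.exists_dense_seq lipBall
  refine ⟨fun n => (d n : C(Disc, ℝ)), fun n => (d n).2, fun ν₁ ν₂ _ _ => ?_⟩
  have hcont (ν : Measure Disc) [IsFiniteMeasure ν] :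
      Continuous fun g : lipBall => ∫ y, (g : C(Disc, ℝ)) y ∂ν :=
    continuous_of_dominated (bound := fun _ => 1)
      (fun g => (g : C(Disc, ℝ)).continuous.aestronglyMeasurable) (fun g => .of_forall g.2.2)
      (integrable_const 1) (.of_forall fun y => by fun_prop)
  have hball (g : lipBall) :
      ENNReal.ofReal (∫ y, (g : C(Disc, ℝ)) y ∂ν₁ - ∫ y, (g : C(Disc, ℝ)) y ∂ν₂) ≤
        ⨆ n, ENNReal.ofReal
          (∫ y, (d n : C(Disc, ℝ)) y ∂ν₁ - ∫ y, (d n : C(Disc, ℝ)) y ∂ν₂) :=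
    hd.induction_on g
      (isClosed_le (ENNReal.continuous_ofReal.comp ((hcont ν₁).sub (hcont ν₂))) continuous_const)
      (le_iSup fun n => ENNReal.ofReal
        (∫ y, (d n : C(Disc, ℝ)) y ∂ν₁ - ∫ y, (d n : C(Disc, ℝ)) y ∂ν₂))
  refine iSup_le fun g => iSup₂_le fun hg hg1 => ?_
  rcases abs_cases (∫ y, g y ∂ν₁ - ∫ y, g y ∂ν₂) with ⟨h, -⟩ | ⟨h, -⟩ <;> rw [h]
  · exact hball ⟨⟨g, hg.continuous⟩, hg, hg1⟩
  · have := hball ⟨⟨fun y => -g y, hg.continuous.neg⟩, hg.neg, fun y => by simpa using hg1 y⟩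
    simp only [ContinuousMap.coe_mk, integral_neg] at this
    rwa [neg_sub_neg, ← neg_sub] at this

end Wasserstein

section WeakNorm

variable {μ : SignedMeasure SolidTorus}

/-- By gluing, a finite maximum of leafwise pairings is again attained by a test function. -/
theorem IsAB.weakNorm_le (hμ : IsAB μ) {C : ℝ}
    (hC : ∀ h, IsLeafLipschitz 1 h → ∫ᵛ p, h p ∂<•μ ≤ C) : weakNorm μ ≤ ENNReal.ofReal C := by
  obtain ⟨g, hg, hwass⟩ := exists_seq_wasserstein_le
  have hgL (n : ℕ) : IsLeafLipschitz 1 fun p => g n p.2 :=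
    ⟨(hg n).1.continuous.measurable.comp measurable_snd, fun p => (hg n).2 p.2, fun _ => (hg n).1⟩
  choose h hh hsups using IsLeafLipschitz.exists_leafPairing_eq_partialSups μ hgL
  have hle (n : ℕ) : ∫⁻ γ, ENNReal.ofReal (leafPairing μ (h n) γ) ≤ ENNReal.ofReal C := by
    obtain ⟨k, hk, hmax⟩ := IsLeafLipschitz.exists_leafPairing_eq_max μ (hh n)
      (h := 0) ⟨measurable_const, by simp, fun _ => LipschitzWith.const _ |>.weaken zero_le_one⟩
    have hmax' (γ : UnitAddCircle) : leafPairing μ k γ = max (leafPairing μ (h n) γ) 0 := by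
      simpa [leafPairing] using hmax γ
    calc ∫⁻ γ, ENNReal.ofReal (leafPairing μ (h n) γ)
        ≤ ∫⁻ γ, ENNReal.ofReal (leafPairing μ k γ) := by
          gcongr with γ
          exact (le_max_left _ _).trans_eq (hmax' γ).symm
      _ = ENNReal.ofReal (∫ᵛ p, k p ∂<•μ) := by
          rw [← hk.integral_leafPairing hμ, ofReal_integral_eq_lintegral_ofReal
            (hk.integrable_leafPairing hμ)
            (.of_forall fun γ => (le_max_right _ _).trans_eq (hmax' γ).symm)]
      _ ≤ ENNReal.ofReal C := ENNReal.ofReal_le_ofReal (hC k hk)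
  calc weakNorm μ ≤ ∫⁻ γ, ⨆ n, ENNReal.ofReal (leafPairing μ (h n) γ) := by
        refine lintegral_mono_ae ?_
        filter_upwards [ae_isFiniteMeasure_leaf (pos μ), ae_isFiniteMeasure_leaf (neg μ)]
          with γ _ _
        refine (hwass _ _).trans (iSup_mono fun n => ENNReal.ofReal_le_ofReal ?_)
        rw [hsups]
        exact le_partialSups (fun i => leafPairing μ fun p => g i p.2) n γ
    _ = ⨆ n, ∫⁻ γ, ENNReal.ofReal (leafPairing μ (h n) γ) := by
        refine lintegral_iSup
          (fun n => (measurable_leafPairing μ (hh n).measurable).ennreal_ofReal) fun m n hmn γ => ?_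
        rw [hsups, hsups]
        exact ENNReal.ofReal_le_ofReal
          ((partialSups fun i => leafPairing μ fun p => g i p.2).monotone hmn γ)
    _ ≤ ENNReal.ofReal C := iSup_le hle

theorem IsAB.mem_spaceL1 (hμ : IsAB μ) : μ ∈ spaceL1 := by
  have hbound (h : SolidTorus → ℝ) (hh : IsLeafLipschitz 1 h) :=
    VectorMeasure.norm_integral_le_of_norm_le_const (μ := μ)
      (B := (ContinuousLinearMap.lsmul ℝ ℝ).flip) (f := h) (.of_forall hh.abs_le)
  exact ⟨hμ, (hμ.weakNorm_le fun h hh => (le_abs_self _).trans (hbound h hh)).trans_lt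
    ENNReal.ofReal_lt_top⟩

end WeakNorm

section WeakConvergence

variable {X : Type*} [MeasurableSpace X]

theorem ext_of_forall_lipschitzWith_integral_eq [PseudoMetricSpace X] [BorelSpace X]
    {ν₁ ν₂ : Measure X} [IsFiniteMeasure ν₁] [IsFiniteMeasure ν₂]
    (h : ∀ (ψ : X → ℝ) (K : ℝ≥0), LipschitzWith K ψ → ∫ x, ψ x ∂ν₁ = ∫ x, ψ x ∂ν₂) :
    ν₁ = ν₂ := by
  refine Measure.ext fun E hE => (measureReal_eq_measureReal_iff).1 ?_
  refine eq_of_abs_sub_le_all fun ε hε => ?_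
  obtain ⟨ψ, K, hK, hψ, hle⟩ :=
    exists_lipschitzWith_integral_abs_sub_indicator_le (m := ν₁ + ν₂) hE hε
  obtain ⟨hψ₁, hψ₂⟩ := integrable_add_measure.1 hψ
  have hE' (ν : Measure X) [IsFiniteMeasure ν] : Integrable (E.indicator (1 : X → ℝ)) ν :=
    (integrable_const 1).indicator hE
  have herr {ν : Measure X} [IsFiniteMeasure ν] (hψν : Integrable ψ ν) :
      |∫ x, ψ x ∂ν - ν.real E| ≤ ∫ x, |ψ x - E.indicator 1 x| ∂ν := by
    rw [← integral_indicator_one hE, ← integral_sub hψν (hE' ν)]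
    exact abs_integral_le_integral_abs
  rw [integral_add_measure (by exact (hψ₁.sub (hE' ν₁)).abs)
    (by exact (hψ₂.sub (hE' ν₂)).abs)] at hle
  have herr₁ := herr hψ₁
  have herr₂ := herr hψ₂
  rw [h ψ K hK, abs_sub_comm] at herr₁
  exact (abs_sub_le _ (∫ x, ψ x ∂ν₂) _).trans (by linarith)

theorem le_of_tendsto_of_forall_le [TopologicalSpace X] [BorelSpace X] [HasOuterApproxClosed X]
    {ι : Type*} {l : Filter ι} [l.NeBot] {r : ι → ProbabilityMeasure X} {ρ : ProbabilityMeasure X}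
    (hr : Tendsto r l (𝓝 ρ)) {κ : Measure X} [κ.OuterRegular]
    (hle : ∀ i, (r i : Measure X) ≤ κ) : (ρ : Measure X) ≤ κ := by
  have hopen (U : Set X) (hU : IsOpen U) : (ρ : Measure X) U ≤ κ U :=
    (ProbabilityMeasure.le_liminf_measure_open_of_tendsto hr hU).trans <|
      liminf_le_of_frequently_le' (.of_forall fun i => hle i U)
  refine Measure.le_intro fun E _ _ => ?_
  rw [E.measure_eq_iInf_isOpen κ]
  exact le_iInf₂ fun U hEU => le_iInf fun hU => (measure_mono hEU).trans (hopen U hU)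

end WeakConvergence

section Transfer

variable {F : SolidTorus → SolidTorus} {μ : SignedMeasure SolidTorus}

theorem iterate_transfer (hF : Measurable F) (n : ℕ) :
    (transfer F)^[n] μ = μ.map F^[n] := by
  induction n with
  | zero => exact (VectorMeasure.map_id μ).symm
  | succ n ih =>
    refine VectorMeasure.ext fun E hE => ?_
    rw [Function.iterate_succ_apply', ih, transfer, VectorMeasure.map_apply _ hF hE,
      VectorMeasure.map_apply _ (hF.iterate n) (hF hE),
      VectorMeasure.map_apply _ (hF.iterate (n + 1)) hE, Function.iterate_succ', preimage_comp]

theorem transfer_toSignedMeasure (hF : Measurable F) (ρ : Measure SolidTorus) [IsFiniteMeasure ρ] :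
    transfer F ρ.toSignedMeasure = (ρ.map F).toSignedMeasure := by
  refine VectorMeasure.ext fun E hE => ?_
  rw [transfer, VectorMeasure.map_apply _ hF hE, Measure.toSignedMeasure_apply_measurable (hF hE),
    Measure.toSignedMeasure_apply_measurable hE, map_measureReal_apply hF hE]

theorem integral_iterate_transfer (hF : Measurable F) {h : SolidTorus → ℝ} (hh : Measurable h)
    {c : ℝ} (hc : ∀ p, |h p| ≤ c) (n : ℕ) :
    ∫ᵛ p, h p ∂<•((transfer F)^[n] μ) = ∫ᵛ p, h (F^[n] p) ∂<•μ := by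
  rw [iterate_transfer hF]
  exact VectorMeasure.integral_map (hF.iterate n) hh.aestronglyMeasurable
    (.of_bound (hh.comp (hF.iterate n)).aestronglyMeasurable c (.of_forall fun p => hc _))

theorem exists_isLeafLipschitz {ψ : SolidTorus → ℝ} {K : ℝ≥0} (hψ : LipschitzWith K ψ) :
    ∃ c, IsLeafLipschitz c ψ := by
  obtain ⟨B, hB⟩ := isCompact_univ.exists_bound_of_continuousOn hψ.continuous.continuousOn
  refine ⟨max K B.toNNReal, hψ.continuous.measurable, fun p => ?_, fun x => ?_⟩
  · exact (hB p (mem_univ p)).trans ((Real.le_coe_toNNReal B).trans (by simp))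
  · exact ((hψ.comp (LipschitzWith.prodMk_left x)).weaken (by simp))

theorem IsAB.eq_zero_of_weakNorm_eq_zero (hμ : IsAB μ) (h0 : weakNorm μ = 0) : μ = 0 := by
  have hpos : pos μ = neg μ := by
    refine ext_of_forall_lipschitzWith_integral_eq fun ψ K hψ => sub_eq_zero.1 ?_
    obtain ⟨c, hc⟩ := exists_isLeafLipschitz hψ
    rw [← integral_eq_integral_pos_sub_integral_neg μ hc.measurable hc.abs_le]
    simpa [h0] using hc.abs_integral_le hμ.mem_spaceL1
  refine VectorMeasure.ext fun E hE => ?_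
  rw [← μ.toSignedMeasure_toJordanDecomposition, JordanDecomposition.toSignedMeasure,
    Measure.toSignedMeasure_sub_apply hE]
  change (pos μ).real E - (neg μ).real E = 0
  rw [hpos, sub_self]

end Transfer

section SkewProduct

variable {T : UnitAddCircle → UnitAddCircle} {G : SolidTorus → Disc} {a b : ℝ} {α : ℝ≥0}

theorem IsC2FiberMap.continuous (hG : IsC2FiberMap G) : Continuous G := by
  obtain ⟨g, hg, hgG⟩ := hG
  have hquot : IsOpenQuotientMap (Prod.map ((↑) : ℝ → UnitAddCircle) (id : Disc → Disc)) :=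
    QuotientAddGroup.isOpenQuotientMap_mk.prodMap .id
  have hlift : Subtype.val ∘ G ∘ Prod.map ((↑) : ℝ → UnitAddCircle) (id : Disc → Disc) =
      fun p : ℝ × Disc => g (p.1, p.2) :=
    funext fun p => (hgG p.1 p.2).symm
  rw [hquot.isQuotientMap.continuous_iff, continuous_induced_rng, hlift]
  exact hg.continuousOn.comp_continuous (by fun_prop) fun p => ⟨mem_univ _, p.2.2⟩

/-- A continuous skew product whose base map contracts the cone of `a`-log-Lipschitz densities and
which contracts every leaf by the factor `α`: the two mechanisms behind the convergence to
equilibrium of a solenoidal map. -/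
structure ContractingSkewProduct (T : UnitAddCircle → UnitAddCircle) (G : SolidTorus → Disc)
    (a b : ℝ) (α : ℝ≥0) : Prop where
  contractsCone : ContractsCone volume T a b
  continuous : Continuous (skewProduct T G)
  contraction_lt_one : α < 1
  lipschitzWith : ∀ x, LipschitzWith α fun y => G (x, y)

theorem IsSolenoidal.exists_contractingSkewProduct (hF : IsSolenoidal T G) :
    ∃ a b α, ContractingSkewProduct T G a b α := by
  obtain ⟨hT, a, b, hcone⟩ := hF.expanding.continuous_and_exists_contractsCone
  obtain ⟨α, hα0, hα1, hα⟩ := hF.contracting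
  exact ⟨a, b, ⟨α, hα0.le⟩, hcone, (hT.comp continuous_fst).prodMk hF.smooth.continuous, hα1,
    fun x => .of_dist_le_mul (hα x)⟩

theorem fst_iterate_skewProduct (n : ℕ) (p : SolidTorus) :
    ((skewProduct T G)^[n] p).1 = T^[n] p.1 := by
  induction n generalizing p with
  | zero => rfl
  | succ n ih => rw [Function.iterate_succ_apply, ih]; rfl

/-- The centre of the disc, which serves as base point of the leaves. -/
def Disc.center : Disc := ⟨0, by simp⟩

namespace ContractingSkewProduct

variable (S : ContractingSkewProduct T G a b α) {μ : SignedMeasure SolidTorus}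
  {c : ℝ≥0} {h : SolidTorus → ℝ}

include S

theorem measurable_iterate (n : ℕ) : Measurable (skewProduct T G)^[n] :=
  S.continuous.measurable.iterate n

theorem fst_map_iterate (ν : Measure SolidTorus) (n : ℕ) :
    (ν.map (skewProduct T G)^[n]).fst = ν.fst.map T^[n] := by
  rw [Measure.fst, Measure.fst, Measure.map_map measurable_fst (S.measurable_iterate n),
    Measure.map_map (S.contractsCone.measurable.iterate n) measurable_fst]
  congr 1
  exact funext fun p => fst_iterate_skewProduct n p

theorem fst_map_iterate_absolutelyContinuous {ν : Measure SolidTorus} (hν : ν.fst ≪ volume)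
    (n : ℕ) : (ν.map (skewProduct T G)^[n]).fst ≪ volume := by
  rw [S.fst_map_iterate]
  exact (hν.map (S.contractsCone.measurable.iterate n)).trans <|
    (S.contractsCone.map_iterate_le n).absolutelyContinuous.trans Measure.smul_absolutelyContinuous

theorem isAB_iterate_transfer (hμ : IsAB μ) (n : ℕ) :
    IsAB ((transfer (skewProduct T G))^[n] μ) := by
  rw [iterate_transfer S.continuous.measurable]
  exact isAB_of_variation_le VectorMeasure.variation_map_le
    (S.fst_map_iterate_absolutelyContinuous (isAB_iff.1 hμ) n)

theorem lipschitzWith_snd_iterate (n : ℕ) (x : UnitAddCircle) :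
    LipschitzWith (α ^ n) fun y => ((skewProduct T G)^[n] (x, y)).2 := by
  induction n generalizing x with
  | zero =>
    rw [pow_zero]
    exact LipschitzWith.id
  | succ n ih =>
    rw [pow_succ]
    exact (ih (T x)).comp (S.lipschitzWith x)

theorem lipschitzWith_comp_iterate (hh : IsLeafLipschitz c h) (n : ℕ) (x : UnitAddCircle) :
    LipschitzWith (c * α ^ n) fun y => h ((skewProduct T G)^[n] (x, y)) := by
  have hfst (y : Disc) :
      (T^[n] x, ((skewProduct T G)^[n] (x, y)).2) = (skewProduct T G)^[n] (x, y) :=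
    Prod.ext (fst_iterate_skewProduct n (x, y)).symm rfl
  simpa only [Function.comp_def, hfst] using
    (hh.lipschitzWith (T^[n] x)).comp (S.lipschitzWith_snd_iterate n x)

theorem isLeafLipschitz_comp_iterate (hh : IsLeafLipschitz c h) (n : ℕ) :
    IsLeafLipschitz c fun p => h ((skewProduct T G)^[n] p) where
  measurable := hh.measurable.comp (S.measurable_iterate n)
  abs_le _ := hh.abs_le _
  lipschitzWith x := (S.lipschitzWith_comp_iterate hh n x).weaken
    (mul_le_of_le_one_right' (pow_le_one₀ zero_le S.contraction_lt_one.le))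

/-- The disc has radius `1`, so the oscillation from the centre of a leaf is at most the Lipschitz
constant. -/
theorem isLeafLipschitz_comp_iterate_sub_center (hh : IsLeafLipschitz c h) (n : ℕ) :
    IsLeafLipschitz (c * α ^ n) fun p =>
      h ((skewProduct T G)^[n] p) - h ((skewProduct T G)^[n] (p.1, Disc.center)) where
  measurable := (hh.measurable.comp (S.measurable_iterate n)).sub
    (hh.measurable.comp ((S.measurable_iterate n).comp (measurable_fst.prodMk measurable_const)))
  abs_le p := by
    have := (S.lipschitzWith_comp_iterate hh n p.1).dist_le_mul p.2 Disc.center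
    rw [Real.dist_eq] at this
    exact this.trans (mul_le_of_le_one_right (NNReal.coe_nonneg _) p.2.2)
  lipschitzWith x := LipschitzWith.of_dist_le_mul fun y₁ y₂ => by
    rw [dist_sub_right]
    exact (S.lipschitzWith_comp_iterate hh n x).dist_le_mul y₁ y₂

/-- The last `k` iterates squeeze the leaves, which makes the test function nearly constant along
them; the first `l` iterates then only act through the base. -/
theorem weakNorm_iterate_transfer_le (hμ : IsAB μ) (k l : ℕ) {C : ℝ}
    (hC : ∀ v, Measurable v → (∀ x, |v x| ≤ 1) →
      |∫ γ, v (T^[l] γ) * marginalDensity μ γ| ≤ C) :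
    weakNorm ((transfer (skewProduct T G))^[k + l] μ) ≤
      ENNReal.ofReal (α ^ k * (weakNorm μ).toReal + C) := by
  set F := skewProduct T G
  refine (S.isAB_iterate_transfer hμ _).weakNorm_le fun h hh => ?_
  set v : UnitAddCircle → ℝ := fun x => h (F^[k] (x, Disc.center))
  have hv : Measurable v :=
    hh.measurable.comp ((S.measurable_iterate k).comp measurable_prodMk_right)
  have hv1 (x : UnitAddCircle) : |v x| ≤ 1 := hh.abs_le _
  have hvl : Measurable fun x => v (T^[l] x) := hv.comp (S.contractsCone.measurable.iterate l)
  set r : SolidTorus → ℝ := fun p => h (F^[k] (F^[l] p)) - v (F^[l] p).1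
  have hr : IsLeafLipschitz (1 * α ^ k) r :=
    S.isLeafLipschitz_comp_iterate (S.isLeafLipschitz_comp_iterate_sub_center hh k) l
  have hsplit (p : SolidTorus) : h (F^[k + l] p) = r p + v (T^[l] p.1) := by
    rw [Function.iterate_add_apply, ← fst_iterate_skewProduct (G := G), sub_add_cancel]
  have hvi : μ.Integrable fun p => v (T^[l] p.1) :=
    .of_bound (hvl.comp measurable_fst).aestronglyMeasurable 1 (.of_forall fun p => hv1 _)
  calc ∫ᵛ p, h p ∂<•((transfer F)^[k + l] μ)
      = ∫ᵛ p, r p ∂<•μ + ∫ γ, v (T^[l] γ) * marginalDensity μ γ := by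
        rw [integral_iterate_transfer S.continuous.measurable hh.measurable hh.abs_le,
          funext hsplit, VectorMeasure.integral_fun_add (hr.integrable _) hvi,
          hμ.integral_comp_fst hvl fun x => hv1 _]
    _ ≤ α ^ k * (weakNorm μ).toReal + C := by
        refine add_le_add ((le_abs_self _).trans ?_) ((le_abs_self _).trans (hC v hv hv1))
        simpa using hr.abs_integral_le hμ.mem_spaceL1

theorem tendsto_weakNorm_iterate_transfer (hμ : IsAB μ) (h0 : μ univ = 0) :
    Tendsto (fun n => weakNorm ((transfer (skewProduct T G))^[n] μ)) atTop (𝓝 0) := by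
  refine ENNReal.tendsto_nhds_zero.2 fun ε hε => ?_
  obtain ⟨δ, hδ, hδε⟩ := ENNReal.lt_iff_exists_nnreal_btwn.1 hε
  have hδ2 : 0 < (δ : ℝ) / 2 := half_pos (by exact_mod_cast hδ)
  obtain ⟨k, hk⟩ : ∃ k : ℕ, (α : ℝ) ^ k * (weakNorm μ).toReal < δ / 2 := by
    have := (tendsto_pow_atTop_nhds_zero_of_lt_one α.coe_nonneg
      S.contraction_lt_one).mul_const (weakNorm μ).toReal
    rw [zero_mul] at this
    exact (this.eventually_lt_const hδ2).exists
  have hmix := S.contractsCone.eventually_abs_integral_comp_iterate_mul_sub_integral_le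
    (integrable_marginalDensity μ) hδ2
  simp only [hμ.integral_marginalDensity, h0, sub_zero] at hmix
  obtain ⟨N, hN⟩ := eventually_atTop.1 hmix
  filter_upwards [eventually_ge_atTop (k + N)] with n hn
  obtain ⟨l, rfl⟩ := Nat.exists_eq_add_of_le hn
  rw [add_assoc]
  refine (S.weakNorm_iterate_transfer_le hμ k (N + l) (hN (N + l) (by omega))).trans ?_
  calc ENNReal.ofReal (α ^ k * (weakNorm μ).toReal + δ / 2)
      ≤ ENNReal.ofReal δ := ENNReal.ofReal_le_ofReal (by linarith)
    _ ≤ ε := by simpa using hδε.le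

end ContractingSkewProduct

end SkewProduct

section ExponentialConvergence

variable {T : UnitAddCircle → UnitAddCircle} {G : SolidTorus → Disc} {a b : ℝ} {α : ℝ≥0}

theorem pow_le_inv_mul_pow {ρ β : ℝ} (hρ : 0 ≤ ρ) (hβ : 0 < β) (hβ1 : β ≤ 1) (hρβ : √ρ ≤ β)
    {m n : ℕ} (hnm : n ≤ 2 * m + 1) : ρ ^ m ≤ β⁻¹ * β ^ n := by
  rw [le_inv_mul_iff₀ hβ]
  calc β * ρ ^ m = β * √ρ ^ (2 * m) := by rw [pow_mul, Real.sq_sqrt hρ]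
    _ ≤ β * β ^ (2 * m) := by gcongr
    _ = β ^ (2 * m + 1) := (pow_succ' β (2 * m)).symm
    _ ≤ β ^ n := pow_le_pow_of_le_one hβ.le hβ1 hnm

theorem le_mul_add_sobolevNorm {φ : UnitAddCircle → ℝ} {w x : ℝ≥0∞} {K : ℝ} (hK : 0 < K)
    (h : ∀ f f', HasL1Deriv f f' → f =ᵐ[volume] φ →
      w ≤ ENNReal.ofReal K * (x + ENNReal.ofReal (∫ γ, |f' γ|))) :
    w ≤ ENNReal.ofReal K * (x + sobolevNorm φ) := by
  have hK0 : ENNReal.ofReal K ≠ 0 := (ENNReal.ofReal_pos.2 hK).ne'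
  rw [← ENNReal.div_le_iff' hK0 ENNReal.ofReal_ne_top, ← tsub_le_iff_left]
  refine le_iInf₂ fun f f' => le_iInf₂ fun hf hfφ => ?_
  have hnorm : ENNReal.ofReal (∫ γ, |f' γ|) = eLpNorm f' 1 volume := by
    rw [eLpNorm_one_eq_lintegral_enorm, ← ofReal_integral_norm_eq_lintegral_enorm hf.1]
    rfl
  have := h f f' hf hfφ
  rw [← ENNReal.div_le_iff' hK0 ENNReal.ofReal_ne_top, ← tsub_le_iff_left, hnorm] at this
  exact this.trans le_add_self

namespace ContractingSkewProduct

variable (S : ContractingSkewProduct T G a b α)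

include S

theorem weakNorm_iterate_transfer_le_of_hasL1Deriv {μ : SignedMeasure SolidTorus} (hμ : IsAB μ)
    (h0 : μ univ = 0) {f f' : UnitAddCircle → ℝ} (hf : HasL1Deriv f f')
    (hfφ : f =ᵐ[volume] marginalDensity μ) (k l : ℕ) :
    weakNorm ((transfer (skewProduct T G))^[k + l] μ) ≤
      ENNReal.ofReal (α ^ k * (weakNorm μ).toReal +
        2 * (Metric.diam (univ : Set UnitAddCircle) + a⁻¹ + 1) *
          √(coneRate UnitAddCircle a b) ^ l * ∫ γ, |f' γ|) := by
  refine S.weakNorm_iterate_transfer_le hμ k l fun v hv hv1 => ?_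
  have hmean : ∫ γ, f γ = 0 := by rw [integral_congr_ae hfφ, hμ.integral_marginalDensity, h0]
  have hdensity : ∫ γ, v (T^[l] γ) * marginalDensity μ γ = ∫ γ, v (T^[l] γ) * f γ :=
    integral_congr_ae (hfφ.mono fun γ hγ => by simp only [hγ])
  have := S.contractsCone.abs_integral_comp_iterate_mul_sub_integral_le_of_hasL1Deriv hv hv1 hf l
  simpa only [hdensity, hmean, sub_zero] using this

theorem exponential_convergence : ∃ D β : ℝ, 0 < D ∧ 0 < β ∧ β < 1 ∧
    ∀ μ, IsAB μ → μ univ = 0 → ∀ n : ℕ, weakNorm ((transfer (skewProduct T G))^[n] μ) ≤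
      ENNReal.ofReal (D * β ^ n) * (weakNorm μ + sobolevNorm (marginalDensity μ)) := by
  set θ := coneRate UnitAddCircle a b
  have hθ : 0 < θ := S.contractsCone.coneRate_pos
  have ha : 0 < a⁻¹ := inv_pos.2 S.contractsCone.left_pos
  set C := 2 * (Metric.diam (univ : Set UnitAddCircle) + a⁻¹ + 1)
  have hC : 1 ≤ C := by linarith [Metric.diam_nonneg (s := (univ : Set UnitAddCircle))]
  set β := max (√α) (√√θ)
  have hβ0 : 0 < β := lt_max_of_lt_right (by positivity)
  have hsqrt {x : ℝ} (hx : x < 1) : √x < 1 := (Real.sqrt_lt' one_pos).2 (by rwa [one_pow])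
  have hβ1 : β < 1 :=
    max_lt (hsqrt S.contraction_lt_one) (hsqrt (hsqrt S.contractsCone.coneRate_lt_one))
  refine ⟨C * β⁻¹, β, by positivity, hβ0, hβ1, fun μ hμ h0 n =>
    le_mul_add_sobolevNorm (by positivity) fun f f' hf hfφ => ?_⟩
  have hα : (α : ℝ) ^ (n / 2) ≤ C * β⁻¹ * β ^ n := by
    rw [mul_assoc C]
    exact (pow_le_inv_mul_pow α.coe_nonneg hβ0 hβ1.le (le_max_left _ _)
      (by omega : n ≤ 2 * (n / 2) + 1)).trans (le_mul_of_one_le_left (by positivity) hC)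
  have hCθ : C * √θ ^ (n - n / 2) ≤ C * β⁻¹ * β ^ n := by
    rw [mul_assoc C]
    exact mul_le_mul_of_nonneg_left (pow_le_inv_mul_pow θ.sqrt_nonneg hβ0 hβ1.le
      (le_max_right _ _) (by omega : n ≤ 2 * (n - n / 2) + 1)) (by positivity)
  have hf' : 0 ≤ ∫ γ, |f' γ| := integral_nonneg fun γ => abs_nonneg _
  calc weakNorm ((transfer (skewProduct T G))^[n] μ)
      ≤ ENNReal.ofReal (α ^ (n / 2) * (weakNorm μ).toReal +
          C * √θ ^ (n - n / 2) * ∫ γ, |f' γ|) := by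
        have := S.weakNorm_iterate_transfer_le_of_hasL1Deriv hμ h0 hf hfφ (n / 2) (n - n / 2)
        rwa [Nat.add_sub_cancel' (Nat.div_le_self n 2)] at this
    _ ≤ ENNReal.ofReal (C * β⁻¹ * β ^ n * ((weakNorm μ).toReal + ∫ γ, |f' γ|)) := by
        rw [mul_add]
        gcongr
    _ = ENNReal.ofReal (C * β⁻¹ * β ^ n) * (weakNorm μ + ENNReal.ofReal (∫ γ, |f' γ|)) := by
        rw [ENNReal.ofReal_mul (by positivity), ENNReal.ofReal_add ENNReal.toReal_nonneg hf',
          ENNReal.ofReal_toReal hμ.mem_spaceL1.2.ne]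

end ContractingSkewProduct

end ExponentialConvergence

section InvariantMeasure

namespace ContractingSkewProduct

variable {T : UnitAddCircle → UnitAddCircle} {G : SolidTorus → Disc} {a b : ℝ} {α : ℝ≥0}
  (S : ContractingSkewProduct T G a b α)

include S

theorem eq_smul_of_transfer_eq {μ ν : SignedMeasure SolidTorus} (hμ : IsAB μ) (hμ1 : μ univ = 1)
    (hμF : transfer (skewProduct T G) μ = μ) (hν : IsAB ν)
    (hνF : transfer (skewProduct T G) ν = ν) : ν = ν univ • μ := by
  set η := ν - ν univ • μ
  have hη : IsAB η := hν.sub (hμ.smul _)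
  have hη0 : η univ = 0 := by simp [η, hμ1]
  have hηF : transfer (skewProduct T G) η = η := by
    change VectorMeasure.mapₗ (R := ℝ) (skewProduct T G) η = η
    rw [map_sub, map_smul]
    exact congrArg₂ (fun ν' μ' => ν' - ν univ • μ') hνF hμF
  have hlim := S.tendsto_weakNorm_iterate_transfer hη hη0
  simp only [Function.iterate_fixed hηF] at hlim
  exact sub_eq_zero.1 (hη.eq_zero_of_weakNorm_eq_zero (tendsto_nhds_unique tendsto_const_nhds hlim))

theorem tendsto_integral_comp_iterate_sub {κ₁ κ₂ : Measure SolidTorus} [IsProbabilityMeasure κ₁]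
    [IsProbabilityMeasure κ₂] (h₁ : κ₁.fst ≪ volume) (h₂ : κ₂.fst ≪ volume) {c : ℝ≥0}
    {h : SolidTorus → ℝ} (hh : IsLeafLipschitz c h) :
    Tendsto (fun n => ∫ p, h ((skewProduct T G)^[n] p) ∂κ₁ -
      ∫ p, h ((skewProduct T G)^[n] p) ∂κ₂) atTop (𝓝 0) := by
  set μ := κ₁.toSignedMeasure - κ₂.toSignedMeasure
  have hμ : IsAB μ := (isAB_toSignedMeasure h₁).sub (isAB_toSignedMeasure h₂)
  have h0 : μ univ = 0 := by simp [μ]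
  have hlim := (ENNReal.tendsto_toReal ENNReal.zero_ne_top).comp
    (S.tendsto_weakNorm_iterate_transfer hμ h0)
  replace hlim := hlim.const_mul (c : ℝ)
  rw [ENNReal.toReal_zero, mul_zero] at hlim
  refine squeeze_zero_norm (fun n => ?_) hlim
  have hi (κ : Measure SolidTorus) [IsFiniteMeasure κ] :
      κ.toSignedMeasure.Integrable fun p => h ((skewProduct T G)^[n] p) :=
    (S.isLeafLipschitz_comp_iterate hh n).integrable _
  rw [← VectorMeasure.integral_toSignedMeasure, ← VectorMeasure.integral_toSignedMeasure,
    ← VectorMeasure.integral_sub_vectorMeasure (hi _) (hi _),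
    ← integral_iterate_transfer S.continuous.measurable hh.measurable hh.abs_le]
  exact hh.abs_integral_le (S.isAB_iterate_transfer hμ n).mem_spaceL1

theorem map_eq_of_tendsto_map_iterate {κ : Measure SolidTorus} [IsProbabilityMeasure κ]
    (hκ : κ.fst ≪ volume) {φ : ℕ → ℕ} (hφ : Tendsto φ atTop atTop)
    {r : ℕ → ProbabilityMeasure SolidTorus} {ρ : ProbabilityMeasure SolidTorus}
    (hr : ∀ n, (r n : Measure SolidTorus) = κ.map (skewProduct T G)^[φ n])
    (hlim : Tendsto r atTop (𝓝 ρ)) :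
    (ρ : Measure SolidTorus).map (skewProduct T G) = ρ := by
  set F := skewProduct T G
  have hF : Measurable F := S.continuous.measurable
  have hprob : IsProbabilityMeasure (κ.map F) := Measure.isProbabilityMeasure_map hF.aemeasurable
  have hlimF := (ProbabilityMeasure.continuous_map S.continuous).continuousAt.tendsto.comp hlim
  suffices hlim' : Tendsto r atTop (𝓝 (ρ.map hF.aemeasurable)) from
    congrArg ProbabilityMeasure.toMeasure (tendsto_nhds_unique hlim' hlim)
  rw [tendsto_iff_forall_lipschitz_integral_tendsto] at hlimF ⊢
  rintro ψ hbdd ⟨K, hK⟩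
  obtain ⟨c, hc⟩ := exists_isLeafLipschitz hK
  have hκF : (κ.map F).fst ≪ volume := S.fst_map_iterate_absolutelyContinuous hκ 1
  have hdiff := (S.tendsto_integral_comp_iterate_sub hκF hκ hc).comp hφ
  have heq (n : ℕ) : ∫ p, ψ p ∂((r n).map hF.aemeasurable : Measure SolidTorus) -
      (∫ p, ψ (F^[φ n] p) ∂(κ.map F) - ∫ p, ψ (F^[φ n] p) ∂κ) =
      ∫ p, ψ p ∂(r n : Measure SolidTorus) := by
    have hmap (κ' : Measure SolidTorus) :
        ∫ p, ψ p ∂(κ'.map F^[φ n]) = ∫ p, ψ (F^[φ n] p) ∂κ' :=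
      integral_map (S.measurable_iterate _).aemeasurable hK.continuous.aestronglyMeasurable
    have hcomm : (κ.map F^[φ n]).map F = (κ.map F).map F^[φ n] := by
      rw [Measure.map_map hF (hF.iterate _), Measure.map_map (hF.iterate _) hF,
        ← Function.iterate_succ, ← Function.iterate_succ']
    change ∫ p, ψ p ∂((r n : Measure SolidTorus).map F) - _ = _
    rw [hr, hcomm, hmap, hmap, sub_sub_cancel]
  have := (hlimF ψ hbdd ⟨K, hK⟩).sub hdiff
  rw [sub_zero] at this
  exact this.congr heq

/-- Krylov-Bogolyubov without averaging: by mixing, a weak limit of the iterates of an absolutely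
continuous measure is already invariant. -/
theorem exists_isProbabilityMeasure_map_eq : ∃ ρ : Measure SolidTorus,
    IsProbabilityMeasure ρ ∧ ρ.fst ≪ volume ∧ ρ.map (skewProduct T G) = ρ := by
  set F := skewProduct T G
  let κ : Measure SolidTorus := (volume : Measure UnitAddCircle).prod (.dirac Disc.center)
  have hκ : κ.fst = volume := by simp [κ]
  have hprob (n : ℕ) : IsProbabilityMeasure (κ.map F^[n]) :=
    Measure.isProbabilityMeasure_map (S.measurable_iterate n).aemeasurable
  let r (n : ℕ) : ProbabilityMeasure SolidTorus := ⟨κ.map F^[n], hprob n⟩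
  obtain ⟨ρ, φ, hφ, hlim⟩ := CompactSpace.tendsto_subseq r
  refine ⟨ρ, inferInstance, ?_, S.map_eq_of_tendsto_map_iterate hκ.absolutelyContinuous
    hφ.tendsto_atTop (fun _ => rfl) hlim⟩
  set A := ENNReal.ofReal (Real.exp (a * Metric.diam (univ : Set UnitAddCircle)))
  have : (A • (volume : Measure UnitAddCircle)).OuterRegular :=
    Measure.OuterRegular.smul _ ENNReal.ofReal_ne_top
  have hlim_fst := (ProbabilityMeasure.continuous_map continuous_fst).continuousAt.tendsto.comp hlim
  have hle : (ρ : Measure SolidTorus).fst ≤ A • volume := by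
    refine le_of_tendsto_of_forall_le hlim_fst fun n => ?_
    change (κ.map F^[φ n]).fst ≤ _
    rw [S.fst_map_iterate, hκ]
    exact S.contractsCone.map_iterate_le (φ n)
  exact hle.absolutelyContinuous.trans Measure.smul_absolutelyContinuous

theorem exists_isAB_transfer_eq : ∃ μ : SignedMeasure SolidTorus,
    IsAB μ ∧ 0 ≤ μ ∧ μ univ = 1 ∧ transfer (skewProduct T G) μ = μ := by
  obtain ⟨ρ, _, hρ, hρF⟩ := S.exists_isProbabilityMeasure_map_eq
  refine ⟨ρ.toSignedMeasure, isAB_toSignedMeasure hρ, ρ.zero_le_toSignedMeasure, by simp, ?_⟩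
  rw [transfer_toSignedMeasure S.continuous.measurable, Measure.toSignedMeasure_congr hρF]

end ContractingSkewProduct

end InvariantMeasure

end Solenoid

end

theorem mainTheorem12 (T : UnitAddCircle → UnitAddCircle) (G : Solenoid.SolidTorus → Solenoid.Disc)
    (hF : Solenoid.IsSolenoidal T G) :
    (∃ D β : ℝ, 0 < D ∧ 0 < β ∧ β < 1 ∧
      ∀ μ ∈ Solenoid.zeroAverage, ∀ n : ℕ, 1 ≤ n →
        (Solenoid.transfer (Solenoid.skewProduct T G))^[n] μ ∈ Solenoid.spaceL1 ∧
        Solenoid.weakNorm ((Solenoid.transfer (Solenoid.skewProduct T G))^[n] μ) ≤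
          ENNReal.ofReal (D * β ^ n) *
            (Solenoid.weakNorm μ + Solenoid.sobolevNorm (Solenoid.marginalDensity μ))) ∧
    (∃ μ ∈ Solenoid.spaceL1, 0 ≤ μ ∧ μ Set.univ = 1 ∧
      Solenoid.transfer (Solenoid.skewProduct T G) μ = μ ∧
      ∀ ν ∈ Solenoid.spaceL1, Solenoid.transfer (Solenoid.skewProduct T G) ν = ν →
        ν = ν Set.univ • μ) := by
  obtain ⟨a, b, α, S⟩ := hF.exists_contractingSkewProduct
  refine ⟨?_, ?_⟩
  · obtain ⟨D, β, hD, hβ0, hβ1, hconv⟩ := S.exponential_convergence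
    exact ⟨D, β, hD, hβ0, hβ1, fun μ hμ n _ =>
      ⟨(S.isAB_iterate_transfer hμ.1.1 n).mem_spaceL1, hconv μ hμ.1.1 hμ.2 n⟩⟩
  · obtain ⟨μ, hμ, hpos, hμ1, hμF⟩ := S.exists_isAB_transfer_eq
    exact ⟨μ, hμ.mem_spaceL1, hpos, hμ1, hμF, fun ν hν hνF =>
      S.eq_smul_of_transfer_eq hμ hμ1 hμF hν.1 hνF⟩
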